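/- **Theorem.** Let $IA(1),IA(2),\dots$ be i.i.d. a.s. positive random variables with mean $1$ and finite variance, and let $S$ be a standard (rate one) Poisson process independent of $(IA(k))_{k\ge1}$. For each $n\ge 1$ let $\lambda^n>0$, $\mu^n>0$, let $N^n=n$ be the number of servers, and let $(b_n)$ be real numbers with $b_n\to\infty$ and $b_n/\sqrt n\to0$. Assume that, as $n\to\infty$, $$\frac{\lambda^n}{n}\to\lambda\in(0,\infty),\qquad \frac{N^n\mu^n}{n}\to\mu\in(0,\infty),\qquad \frac{\sqrt n}{b_n}\Big(\frac{\lambda^n}{n}-\frac{N^n\mu^n}{n}\Big)\to r\in\mathbb R .$$ Let $A^n(t)=\sup\{l\ge0:\sum_{k=1}^l IA(k)/\lambda^n\le t\}$ be the arrival process, and let $X^n$ (the number of customers in the $n$-th non-idling G/M/N queue) be the process with right-continuous paths with left limits (RCLL), values in $\{0,1,2,\dots\}$ and deterministic initial value $X^n(0)$ which satisfies almost surely $$X^n(t)=X^n(0)+A^n(t)-S\Big(\mu^n\int_0^t (X^n(s)\wedge N^n)\,ds\Big),\qquad t\ge 0 .$$ Put $$\tilde A^n(t)=\frac{A^n(t)-\lambda^nt}{b_n\sqrt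 n},\quad \tilde S^n_\mu(t)=\frac{S(N^n\mu^nt)-N^n\mu^nt}{b_n\sqrt n},\quad \tilde X^n(t)=\frac{X^n(t)-N^n}{b_n\sqrt n},$$ and assume $\tilde X^n(0)\to x\in\mathbb R$. Fix $T>0$, and let $D([0,T],\mathbb R^k)$ be the space of RCLL functions $[0,T]\to\mathbb R^k$ with the Skorokhod $J_1$ metric. A rate function on a metric space is a $[0,\infty]$-valued function $\mathbb J$ with compact level sets $\{\mathbb J\le a\}$, $a\ge0$; random elements $Y^n$ satisfy the large deviation principle (LDP) with parameter $a_n\to\infty$ and rate function $\mathbb J$ if $\limsup_n a_n^{-1}\log\mathbb P(Y^n\in F)\le-\inf_F\mathbb J$ for every closed $F$ and $\liminf_n a_n^{-1}\log\mathbb P(Y^n\in G)\ge-\inf_G\mathbb J$ for every open $G$. Suppose that $(\tilde A^n,\tilde S^n_\mu)$ satisfies the LDP in $D([0,T],\mathbb R^2)$ with parameter $b_n^2$ and a rate function $\mathbb I$ that equals $\infty$ on discontinuous paths. Then $(\tilde X^n)_{n\ge1}$ satisfies the LDP in $D([0,T],\mathbb R)$ with parameter $b_n^2$ and rate function $$\mathbb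 I_X(\psi)=\inf\Big\{\mathbb I(\psi^1,\psi^2):\ (\psi^1,\psi^2)\in D([0,T],\mathbb R^2),\ \psi(t)=x+rt+\psi^1(t)-\psi^2(t)+\mu\int_0^t(\psi(s))^-\,ds\ \text{ for all } t\in[0,T]\Big\},$$ where $a^-=(-a)\vee0$ and $\inf\emptyset=\infty$. -/

import Mathlib

open MeasureTheory ProbabilityTheory Filter Topology
open scoped NNReal ENNReal

noncomputable section

namespace GMN

/-! ### The Skorokhod space `D([0,T], E)` with the `J₁` metric -/

/-- Right-continuous with left limits (RCLL) at every point of the time set. -/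
def IsCadlag {ι E : Type*} [TopologicalSpace ι] [Preorder ι] [TopologicalSpace E]
    (f : ι → E) : Prop :=
  ∀ t, ContinuousWithinAt f (Set.Ici t) t ∧ ∃ l, Tendsto f (𝓝[<] t) (𝓝 l)

/-- The set `D([0,T], E)` of RCLL functions `[0,T] → E`. -/
def SkorokhodSpace (T : ℝ) (E : Type*) [TopologicalSpace E] : Type _ :=
  {f : Set.Icc (0 : ℝ) T → E // IsCadlag f}

instance {T : ℝ} {E : Type*} [TopologicalSpace E] :
    CoeFun (SkorokhodSpace T E) (fun _ => Set.Icc (0 : ℝ) T → E) := ⟨Subtype.val⟩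

/-- `‖f‖° = sup_{s < t} |log ((f t - f s) / (t - s))|` for a strictly increasing continuous map
of `[0,T]` onto itself (equivalently, an order isomorphism of `[0,T]`); it may be infinite. -/
def timeChangeNorm {T : ℝ} (f : Set.Icc (0 : ℝ) T ≃o Set.Icc (0 : ℝ) T) : ℝ≥0∞ :=
  ⨆ (s : Set.Icc (0 : ℝ) T) (t : Set.Icc (0 : ℝ) T) (_ : s < t),
    ENNReal.ofReal |Real.log (((f t : ℝ) - (f s : ℝ)) / ((t : ℝ) - (s : ℝ)))|

/-- The `J₁` distance
`d(φ, φ') = inf_f (‖f‖° ∨ sup_t ‖φ(t) - φ'(f(t))‖)`. -/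
def skorokhodEDist {T : ℝ} {E : Type*} [MetricSpace E] (φ φ' : SkorokhodSpace T E) : ℝ≥0∞ :=
  ⨅ f : Set.Icc (0 : ℝ) T ≃o Set.Icc (0 : ℝ) T,
    timeChangeNorm f ⊔ ⨆ t : Set.Icc (0 : ℝ) T, edist (φ t) (φ' (f t))

section Metric

variable {T : ℝ} {E : Type*} [MetricSpace E]

theorem le_timeChangeNorm (f : Set.Icc (0 : ℝ) T ≃o Set.Icc (0 : ℝ) T)
    {s t : Set.Icc (0 : ℝ) T} (h : s < t) :
    ENNReal.ofReal |Real.log (((f t : ℝ) - (f s : ℝ)) / ((t : ℝ) - (s : ℝ)))|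
      ≤ timeChangeNorm f :=
  le_iSup_of_le s (le_iSup_of_le t (le_iSup_of_le h le_rfl))

theorem timeChangeNorm_refl : timeChangeNorm (OrderIso.refl (Set.Icc (0 : ℝ) T)) = 0 := by
  refine le_antisymm (iSup_le fun s => iSup_le fun t => iSup_le fun h => ?_) (zero_le)
  have h' : (t : ℝ) - s ≠ 0 := (sub_pos.2 (show (s : ℝ) < t from h)).ne'
  simp [div_self h']

theorem timeChangeNorm_symm_le (f : Set.Icc (0 : ℝ) T ≃o Set.Icc (0 : ℝ) T) :
    timeChangeNorm f.symm ≤ timeChangeNorm f := by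
  refine iSup_le fun s => iSup_le fun t => iSup_le fun h => ?_
  have h2 : f.symm s < f.symm t := f.symm.lt_iff_lt.2 h
  have := le_timeChangeNorm f h2
  rw [OrderIso.apply_symm_apply, OrderIso.apply_symm_apply] at this
  rwa [← inv_div, Real.log_inv, abs_neg]

theorem timeChangeNorm_trans_le (f g : Set.Icc (0 : ℝ) T ≃o Set.Icc (0 : ℝ) T) :
    timeChangeNorm (f.trans g) ≤ timeChangeNorm f + timeChangeNorm g := by
  refine iSup_le fun s => iSup_le fun t => iSup_le fun h => ?_
  have h2 : f s < f t := f.lt_iff_lt.2 h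
  have h3 : g (f s) < g (f t) := g.lt_iff_lt.2 h2
  have p1 : 0 < (t : ℝ) - s := sub_pos.2 h
  have p2 : 0 < (f t : ℝ) - f s := sub_pos.2 h2
  have p3 : 0 < (g (f t) : ℝ) - g (f s) := sub_pos.2 h3
  have key : ((g (f t) : ℝ) - g (f s)) / ((t : ℝ) - s)
      = (((f t : ℝ) - f s) / ((t : ℝ) - s)) * (((g (f t) : ℝ) - g (f s)) / ((f t : ℝ) - f s)) := by
    field_simp
  calc ENNReal.ofReal |Real.log (((g (f t) : ℝ) - g (f s)) / ((t : ℝ) - s))|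
      ≤ ENNReal.ofReal (|Real.log (((f t : ℝ) - f s) / ((t : ℝ) - s))|
          + |Real.log (((g (f t) : ℝ) - g (f s)) / ((f t : ℝ) - f s))|) := by
        rw [key, Real.log_mul (div_pos p2 p1).ne' (div_pos p3 p2).ne']
        exact ENNReal.ofReal_le_ofReal (abs_add_le _ _)
    _ ≤ _ := by
        rw [ENNReal.ofReal_add (abs_nonneg _) (abs_nonneg _)]
        exact add_le_add (le_timeChangeNorm f h) (le_timeChangeNorm g h2)

theorem skorokhodEDist_self (φ : SkorokhodSpace T E) : skorokhodEDist φ φ = 0 := by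
  refine le_antisymm (iInf_le_of_le (OrderIso.refl _) ?_) (zero_le)
  simp [timeChangeNorm_refl]

theorem skorokhodEDist_comm_le (φ φ' : SkorokhodSpace T E) :
    skorokhodEDist φ φ' ≤ skorokhodEDist φ' φ := by
  refine le_iInf fun f => iInf_le_of_le f.symm (sup_le_sup (timeChangeNorm_symm_le f) ?_)
  refine iSup_le fun t => le_iSup_of_le (f.symm t) ?_
  rw [OrderIso.apply_symm_apply, edist_comm]

theorem skorokhodEDist_triangle (φ φ' φ'' : SkorokhodSpace T E) :
    skorokhodEDist φ φ'' ≤ skorokhodEDist φ φ' + skorokhodEDist φ' φ'' := by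
  unfold skorokhodEDist
  rw [ENNReal.iInf_add]
  refine le_iInf fun f => ?_
  rw [ENNReal.add_iInf]
  refine le_iInf fun g => iInf_le_of_le (f.trans g) (sup_le ?_ (iSup_le fun t => ?_))
  · exact (timeChangeNorm_trans_le f g).trans (add_le_add le_sup_left le_sup_left)
  · refine (edist_triangle _ (φ' (f t)) _).trans (add_le_add ?_ ?_)
    · exact le_sup_of_le_right (le_iSup (fun t => edist (φ t) (φ' (f t))) t)
    · exact le_sup_of_le_right (le_iSup (fun t => edist (φ' t) (φ'' (g t))) (f t))

theorem timeChange_bounds (f : Set.Icc (0 : ℝ) T ≃o Set.Icc (0 : ℝ) T) {δ : ℝ} (hδ : 0 ≤ δ)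
    (hf : timeChangeNorm f ≤ ENNReal.ofReal δ) (t : Set.Icc (0 : ℝ) T) (ht : 0 < (t : ℝ)) :
    (t : ℝ) * Real.exp (-δ) ≤ f t ∧ (f t : ℝ) ≤ t * Real.exp δ := by
  let z : Set.Icc (0 : ℝ) T := ⟨0, le_rfl, t.2.1.trans t.2.2⟩
  have hz : f z = z := by
    refine le_antisymm ?_ (f z).2.1
    have : z ≤ f.symm z := (f.symm z).2.1
    simpa using f.monotone this
  have hzt : z < t := ht
  have h1 := (le_timeChangeNorm f hzt).trans hf
  have h2 : f z < f t := f.lt_iff_lt.2 hzt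
  rw [hz] at h1 h2
  have hft : 0 < (f t : ℝ) := h2
  have hz0 : (z : ℝ) = 0 := rfl
  rw [hz0, sub_zero, sub_zero, ENNReal.ofReal_le_ofReal_iff hδ, abs_le] at h1
  have hq : 0 < (f t : ℝ) / t := div_pos hft ht
  constructor
  · have := (Real.le_log_iff_exp_le hq).1 h1.1
    rw [le_div_iff₀ ht] at this
    linarith
  · have := (Real.log_le_iff_le_exp hq).1 h1.2
    rw [div_le_iff₀ ht] at this
    linarith

theorem IsCadlag.right_close {f : Set.Icc (0 : ℝ) T → E} (hf : IsCadlag f)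
    (t : Set.Icc (0 : ℝ) T) {ε : ℝ} (hε : 0 < ε) :
    ∃ r > (t : ℝ), ∀ s : Set.Icc (0 : ℝ) T, (t : ℝ) ≤ s → (s : ℝ) < r → dist (f s) (f t) < ε := by
  obtain ⟨δ, hδ, h⟩ := Metric.continuousWithinAt_iff.1 (hf t).1 ε hε
  refine ⟨t + δ, by linarith, fun s h1 h2 => h h1 ?_⟩
  rw [Subtype.dist_eq, Real.dist_eq, abs_of_nonneg (by linarith)]
  linarith

theorem eq_of_skorokhodEDist_eq_zero {φ φ' : SkorokhodSpace T E}
    (h : skorokhodEDist φ φ' = 0) : φ = φ' := by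
  have ex : ∀ δ : ℝ, 0 < δ → ∃ f : Set.Icc (0 : ℝ) T ≃o Set.Icc (0 : ℝ) T,
      timeChangeNorm f ≤ ENNReal.ofReal δ ∧ ∀ t, dist (φ t) (φ' (f t)) ≤ δ := by
    intro δ hδ
    have : skorokhodEDist φ φ' < ENNReal.ofReal δ := by rw [h]; exact ENNReal.ofReal_pos.2 hδ
    obtain ⟨f, hf⟩ := iInf_lt_iff.1 this
    refine ⟨f, le_sup_left.trans hf.le, fun t => ?_⟩
    have h1 : edist (φ t) (φ' (f t)) ≤ ENNReal.ofReal δ :=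
      (le_iSup (fun t => edist (φ t) (φ' (f t))) t).trans (le_sup_right.trans hf.le)
    rwa [edist_dist, ENNReal.ofReal_le_ofReal_iff hδ.le] at h1
  refine Subtype.ext (funext fun t => ?_)
  refine eq_of_forall_dist_le fun ε hε => ?_
  rcases lt_or_eq_of_le t.2.2 with htT | htT
  · obtain ⟨r, hr, h1⟩ := φ.2.right_close t (ε := ε / 3) (by positivity)
    obtain ⟨r', hr', h2⟩ := φ'.2.right_close t (ε := ε / 3) (by positivity)
    obtain ⟨s, hs1, hs2⟩ := exists_between (lt_min htT (lt_min hr hr'))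
    have hs0 : 0 < s := t.2.1.trans_lt hs1
    have hsT : s < T := hs2.trans_le (min_le_left _ _)
    have hsr : s < r := hs2.trans_le ((min_le_right _ _).trans (min_le_left _ _))
    have hsr' : s < r' := hs2.trans_le ((min_le_right _ _).trans (min_le_right _ _))
    have c1 : Tendsto (fun δ : ℝ => s * Real.exp (-δ)) (𝓝[>] 0) (𝓝 s) := by
      have : Continuous fun δ : ℝ => s * Real.exp (-δ) := by fun_prop
      simpa using (this.tendsto 0).mono_left nhdsWithin_le_nhds
    have c2 : Tendsto (fun δ : ℝ => s * Real.exp δ) (𝓝[>] 0) (𝓝 s) := by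
      have : Continuous fun δ : ℝ => s * Real.exp δ := by fun_prop
      simpa using (this.tendsto 0).mono_left nhdsWithin_le_nhds
    have c3 : ∀ᶠ δ : ℝ in 𝓝[>] 0, δ < ε / 3 :=
      nhdsWithin_le_nhds (eventually_lt_nhds (by positivity))
    obtain ⟨δ, hδ1, hδ2, hδ3, hδ4⟩ := ((c1.eventually_const_lt hs1).and
      ((c2.eventually_lt_const hsr').and (c3.and self_mem_nhdsWithin))).exists
    have hδ0 : (0 : ℝ) < δ := hδ4
    obtain ⟨f, hf1, hf2⟩ := ex δ hδ0
    let s' : Set.Icc (0 : ℝ) T := ⟨s, hs0.le, hsT.le⟩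
    obtain ⟨b1, b2⟩ := timeChange_bounds f hδ0.le hf1 s' hs0
    have e1 := h1 s' hs1.le hsr
    have e2 := h2 (f s') (hδ1.le.trans b1) (b2.trans_lt hδ2)
    have e3 := hf2 s'
    have := dist_triangle4 (φ t) (φ s') (φ' (f s')) (φ' t)
    rw [dist_comm] at e1
    exact (this.trans_lt (by linarith)).le
  · obtain ⟨f, -, hf2⟩ := ex ε hε
    have hft : f t = t := by
      refine le_antisymm (show (f t : ℝ) ≤ t from (f t).2.2.trans_eq htT.symm) ?_
      have : f.symm t ≤ t := show (f.symm t : ℝ) ≤ t from (f.symm t).2.2.trans_eq htT.symm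
      simpa using f.monotone this
    simpa [hft] using hf2 t

end Metric

/-- `D([0,T], E)` with the `J₁` metric. -/
instance {T : ℝ} {E : Type*} [MetricSpace E] : EMetricSpace (SkorokhodSpace T E) where
  edist := skorokhodEDist
  edist_self := skorokhodEDist_self
  edist_comm φ φ' := le_antisymm (skorokhodEDist_comm_le φ φ') (skorokhodEDist_comm_le φ' φ)
  edist_triangle := skorokhodEDist_triangle
  eq_of_edist_eq_zero := eq_of_skorokhodEDist_eq_zero

/-- The Borel `σ`-field of the `J₁` topology. -/
instance {T : ℝ} {E : Type*} [MetricSpace E] : MeasurableSpace (SkorokhodSpace T E) :=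
  borel _

instance {T : ℝ} {E : Type*} [MetricSpace E] : BorelSpace (SkorokhodSpace T E) := ⟨rfl⟩

open Classical in
/-- The restriction to `[0,T]` of a path `f` on `ℝ₊`, as an element of `D([0,T], E)`. It is used
for paths that are almost surely RCLL; on the exceptional null set the value is the zero path. -/
def restrictPath (T : ℝ) {E : Type*} [TopologicalSpace E] [Zero E] (f : ℝ≥0 → E) :
    SkorokhodSpace T E :=
  if h : IsCadlag (fun t : Set.Icc (0 : ℝ) T => f (Real.toNNReal t)) then ⟨_, h⟩
  else ⟨fun _ => 0, fun _ => ⟨continuousWithinAt_const, 0, tendsto_const_nhds⟩⟩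

/-! ### Large deviation principle -/

/-- A rate function: `[0,∞]`-valued with compact level sets. -/
def IsRateFunction {S : Type*} [TopologicalSpace S] (I : S → ℝ≥0∞) : Prop :=
  ∀ a : ℝ≥0, IsCompact {x | I x ≤ a}

/-- The random elements `Y n` of `S` satisfy the large deviation principle with parameter
`a n → ∞` and rate function `I`. -/
structure SatisfiesLDP {Ω S : Type*} [MeasurableSpace Ω] [TopologicalSpace S] [MeasurableSpace S]
    (P : Measure Ω) (Y : ℕ → Ω → S) (a : ℕ → ℝ) (I : S → ℝ≥0∞) : Prop where
  aemeasurable : ∀ n, AEMeasurable (Y n) P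
  tendsto_atTop : Tendsto a atTop atTop
  isRateFunction : IsRateFunction I
  upper : ∀ F : Set S, IsClosed F →
    limsup (fun n => (((a n)⁻¹ : ℝ) : EReal) * ENNReal.log (P {ω | Y n ω ∈ F})) atTop
      ≤ -((⨅ y ∈ F, I y : ℝ≥0∞) : EReal)
  lower : ∀ G : Set S, IsOpen G →
    -((⨅ y ∈ G, I y : ℝ≥0∞) : EReal)
      ≤ liminf (fun n => (((a n)⁻¹ : ℝ) : EReal) * ENNReal.log (P {ω | Y n ω ∈ G})) atTop

/-! ### The single-class G/M/N queue -/

/-- Standard (rate one) Poisson process. -/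
structure IsStandardPoissonProcess {Ω : Type*} [MeasurableSpace Ω] (P : Measure Ω)
    (S : ℝ≥0 → Ω → ℕ) : Prop where
  measurable : ∀ t, Measurable (S t)
  zero : ∀ᵐ ω ∂P, S 0 ω = 0
  paths : ∀ᵐ ω ∂P, Monotone (fun t => S t ω) ∧ IsCadlag (fun t => S t ω)
  indep_increments : HasIndepIncrements (fun t ω => (S t ω : ℝ)) P
  law_increments : ∀ s t, s ≤ t → HasLaw (fun ω => S t ω - S s ω) (poissonMeasure (t - s)) P

/-- I.i.d. positive inter-arrival times with mean one and finite variance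
(`IA k` is the `(k+1)`-st inter-arrival time). -/
structure IsInterArrivalSequence {Ω : Type*} [MeasurableSpace Ω] (P : Measure Ω)
    (IA : ℕ → Ω → ℝ) : Prop where
  measurable : ∀ k, Measurable (IA k)
  indep : iIndepFun IA P
  identDistrib : ∀ k, IdentDistrib (IA k) (IA 0) P P
  pos : ∀ k, ∀ᵐ ω ∂P, 0 < IA k ω
  memLp_two : MemLp (IA 0) 2 P
  mean : ∫ ω, IA 0 ω ∂P = 1

/-- Number of arrivals up to time `t`: `sup {l ≥ 0 : ∑_{k=1}^l IA(k)/λ ≤ t}`. -/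
def arrivals {Ω : Type*} (IA : ℕ → Ω → ℝ) (lam : ℝ) (t : ℝ≥0) (ω : Ω) : ℕ :=
  sSup {l : ℕ | ∑ k ∈ Finset.range l, IA k ω / lam ≤ t}

/-- `X` is the number-in-system process of the non-idling queue with `N` servers of rate `mu`,
arrival process `A`, service clock `S` and initial population `x₀`: it is a process with RCLL paths
and `X(t) = x₀ + A(t) - S(mu ∫₀ᵗ Z(s) ds)` with `Z = X ∧ N`. -/
structure IsCustomerProcess {Ω : Type*} [MeasurableSpace Ω] (P : Measure Ω) (N : ℕ) (mu : ℝ)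
    (A S : ℝ≥0 → Ω → ℕ) (x₀ : ℕ) (X : ℝ≥0 → Ω → ℕ) : Prop where
  measurable : ∀ t, Measurable (X t)
  paths : ∀ᵐ ω ∂P, IsCadlag (fun t => X t ω)
  balance : ∀ᵐ ω ∂P, ∀ t : ℝ≥0, (X t ω : ℤ) = x₀ + A t ω
    - S (Real.toNNReal (mu * ∫ s in (0 : ℝ)..t, ((min (X s.toNNReal ω) N : ℕ) : ℝ))) ω

/-- `Ã(t) = (A(t) - λ t) / (b √n)`. -/
def scaledArrivals (n : ℕ) (b lam : ℝ) (A : ℝ≥0 → ℕ) (t : ℝ≥0) : ℝ :=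
  (A t - lam * t) / (b * √n)

/-- `S̃_μ(t) = (S(N μ t) - N μ t) / (b √n)`. -/
def scaledServices (n : ℕ) (b : ℝ) (N : ℕ) (mu : ℝ) (S : ℝ≥0 → ℕ) (t : ℝ≥0) : ℝ :=
  (S (Real.toNNReal (N * mu * t)) - N * mu * t) / (b * √n)

/-- `X̃(t) = (X(t) - N) / (b √n)`. -/
def scaledCustomers (n : ℕ) (b : ℝ) (N : ℕ) (X : ℝ≥0 → ℕ) (t : ℝ≥0) : ℝ :=
  (X t - N) / (b * √n)

/-! ### The limit equation and the rate function -/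

/-- `ψ` solves `ψ(t) = x + r t + ψ¹(t) - ψ²(t) + μ ∫₀ᵗ ψ(s)⁻ ds` on `[0,T]`. -/
def SolvesLimitEquation {T : ℝ} (hT : 0 ≤ T) (x r mu : ℝ)
    (p : SkorokhodSpace T (EuclideanSpace ℝ (Fin 2))) (ψ : SkorokhodSpace T ℝ) : Prop :=
  ∀ t : Set.Icc (0 : ℝ) T, ψ t = x + r * t + p t 0 - p t 1
    + mu * ∫ s in (0 : ℝ)..t, max (-(Set.IccExtend hT ψ s)) 0

/-- The infimum of `I(ψ¹, ψ²)` over the pairs for which `ψ` is the solution of the limit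
equation. -/
def customersRate {T : ℝ} (hT : 0 ≤ T) (x r mu : ℝ)
    (I : SkorokhodSpace T (EuclideanSpace ℝ (Fin 2)) → ℝ≥0∞) (ψ : SkorokhodSpace T ℝ) : ℝ≥0∞ :=
  ⨅ (p : SkorokhodSpace T (EuclideanSpace ℝ (Fin 2)))
    (_ : SolvesLimitEquation hT x r mu p ψ), I p

end GMN

end

noncomputable section

namespace GMN

/-! ### An extended contraction principle -/

section Contraction

variable {S S' : Type*} [TopologicalSpace S] [TopologicalSpace S']

/-! Put J(t) = ∫₀ᵗ X̃ⁿ(s)⁻ ds. Since X ∧ n = n - (X - n)⁻, the busy time is n t - bₙ√n J(t) = n τ(t)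
with τ(t) = t - (bₙ/√n) J(t), and the balance equation becomes exactly X̃ⁿ(t) = X̃ⁿ(0) + rₙ t +
Ãⁿ(t) - S̃ⁿ(τ(t)) + μⁿ J(t), where rₙ → r (`scaledCustomers_eq`). Apart from the delayed clock τ
this is the limit equation with perturbed data.

The feedback μⁿ J is nonnegative, so a lower bound on the other terms bounds X̃⁻ and hence J
(`negPart_le_of_eq`). As bₙ/√n → 0, τ(t) is then uniformly close to t, and near a continuous driving
path z the delay costs only the modulus of continuity of z. Gronwall puts X̃ⁿ uniformly close to the
solution F(z) driven by z (`dist_scaledCustomers_le`). The estimate is pathwise. It applies in the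
J₁ topology because a J₁-neighbourhood of a continuous path contains only uniformly close paths,
while uniformly close paths are always J₁-close; discontinuous z have infinite rate.

Because X̃ⁿ is not a fixed function of the scaled primitives, the contraction principle is replaced
by a variant (`SatisfiesLDP.extended_contraction`): it is enough that, almost surely, Y n is near
F(z) once n is large and Z n is near z. Existence and uniqueness for the limit equation along
continuous paths identify the resulting rate with the stated infimum (`customersRate_eq`).

The LDP also includes measurability for the Borel field of J₁. This comes from approximating X̃ⁿ by
step paths with countably many possible values (`tendsto_stepPath`). -/

/-- A rate function on a Hausdorff space is lower semicontinuous. -/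
theorem IsRateFunction.lowerSemicontinuous [T2Space S] {I : S → ℝ≥0∞} (hI : IsRateFunction I) :
    LowerSemicontinuous I := by
  refine lowerSemicontinuous_iff_isClosed_preimage.2 fun y => ?_
  induction y with
  | top => simp
  | coe a => exact (hI a).isClosed

/-- The image of a rate function under a map that is continuous where the rate is finite. -/
theorem IsRateFunction.map [T2Space S] [T1Space S'] {I : S → ℝ≥0∞} (hI : IsRateFunction I)
    {F : S → S'} (hF : ContinuousOn F {z | I z ≠ ⊤}) :
    IsRateFunction fun y => ⨅ (z : S) (_ : F z = y), I z := by
  intro a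
  have hFa : ∀ c : ℝ≥0, ContinuousOn F {z | I z ≤ c} := fun c =>
    hF.mono fun z hz => (lt_of_le_of_lt hz ENNReal.coe_lt_top).ne
  suffices h : {y | ⨅ (z : S) (_ : F z = y), I z ≤ a} = F '' {z | I z ≤ a} by
    rw [h]; exact (hI a).image_of_continuousOn (hFa a)
  ext y
  simp only [Set.mem_ofPred_eq, Set.mem_image]
  constructor
  · intro hy
    -- The hypothesis bounds only an infimum, so a point of the fibre with rate at most `a` is not
    -- yet available. At level `a + 1` the fibre is nonempty and compact, and lower semicontinuity
    -- gives a minimiser; fibre points above that level cannot lower the infimum.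
    have hK : IsCompact ({z | I z ≤ (a + 1 : ℝ≥0)} ∩ F ⁻¹' {y}) :=
      (hI (a + 1)).of_isClosed_subset
        ((hFa _).preimage_isClosed_of_isClosed (hI (a + 1)).isClosed isClosed_singleton)
        Set.inter_subset_left
    have ha : (a : ℝ≥0∞) < (a + 1 : ℝ≥0) := by exact_mod_cast lt_add_one a
    have hne : ({z | I z ≤ (a + 1 : ℝ≥0)} ∩ F ⁻¹' {y}).Nonempty := by
      obtain ⟨z, hz⟩ := iInf_lt_iff.1 (hy.trans_lt ha)
      obtain ⟨h1, h2⟩ := iInf_lt_iff.1 hz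
      exact ⟨z, h2.le, h1⟩
    obtain ⟨z, ⟨-, hz2⟩, hmin⟩ :=
      (hI.lowerSemicontinuous.lowerSemicontinuousOn _).exists_isMinOn hne hK
    refine ⟨z, ?_, hz2⟩
    by_contra! hlt
    have : min (I z) (a + 1 : ℝ≥0) ≤ ⨅ (z : S) (_ : F z = y), I z := by
      refine le_iInf fun w => le_iInf fun hw => ?_
      rcases le_total (I w) (a + 1 : ℝ≥0) with h | h
      · exact (min_le_left _ _).trans (hmin ⟨h, hw⟩)
      · exact (min_le_right _ _).trans h
    exact absurd (this.trans hy) (not_le.2 (lt_min hlt ha))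
  · rintro ⟨z, hz, rfl⟩
    exact iInf_le_of_le z (iInf_le_of_le rfl hz)

/-- Infima of a rate function over a decreasing sequence of closed sets. -/
theorem IsRateFunction.exists_mem_iInter_le [T2Space S] {I : S → ℝ≥0∞} (hI : IsRateFunction I)
    {C : ℕ → Set S} (hC : ∀ m, IsClosed (C m)) (hanti : Antitone C) {a : ℝ≥0}
    (h : ∀ m, ⨅ z ∈ C m, I z < a) : ∃ z, (∀ m, z ∈ C m) ∧ I z ≤ a := by
  obtain ⟨z, hz⟩ := IsCompact.nonempty_iInter_of_sequence_nonempty_isCompact_isClosed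
    (fun m => {z | I z ≤ a} ∩ C m)
    (fun m => Set.inter_subset_inter_right _ (hanti (Nat.le_succ m)))
    (fun m => by
      obtain ⟨z, hz⟩ := iInf_lt_iff.1 (h m)
      obtain ⟨h1, h2⟩ := iInf_lt_iff.1 hz
      exact ⟨z, h2.le, h1⟩)
    ((hI a).inter_right (hC 0)) (fun m => (hI a).isClosed.inter (hC m))
  rw [Set.mem_iInter] at hz
  exact ⟨z, fun m => (hz m).2, (hz 0).1⟩

variable {Ω : Type*} [MeasurableSpace Ω] [MeasurableSpace S] [MeasurableSpace S']

theorem inv_mul_log_mono {c : ℝ} (hc : 0 ≤ c) {p q : ℝ≥0∞} (h : p ≤ q) :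
    ((c⁻¹ : ℝ) : EReal) * ENNReal.log p ≤ ((c⁻¹ : ℝ) : EReal) * ENNReal.log q :=
  mul_le_mul_of_nonneg_left (ENNReal.log_le_log_iff.2 h) (by exact_mod_cast inv_nonneg.2 hc)

theorem measure_le_of_forall_mem {P : Measure Ω} {Ω₀ A B : Set Ω} (h₀ : P Ω₀ᶜ = 0)
    (h : ∀ ω ∈ Ω₀, ω ∈ A → ω ∈ B) : P A ≤ P B := by
  refine measure_mono_ae ?_
  have : ∀ᵐ ω ∂P, ω ∈ Ω₀ := h₀
  filter_upwards [this] with ω hω hA using h ω hω hA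

/-- Extended contraction principle: `Y n` need not be a function of `Z n`; it suffices that on an
almost sure event `Y n` is close to `F z` whenever `n` is large and `Z n` is close to `z`. -/
theorem SatisfiesLDP.extended_contraction [T2Space S] [T1Space S'] {P : Measure Ω}
    {Z : ℕ → Ω → S} {a : ℕ → ℝ} {I : S → ℝ≥0∞} (h : SatisfiesLDP P Z a I)
    {Y : ℕ → Ω → S'} (hY : ∀ n, AEMeasurable (Y n) P)
    {F : S → S'} (hF : ContinuousOn F {z | I z ≠ ⊤}) {Ω₀ : Set Ω} (h₀ : P Ω₀ᶜ = 0)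
    (hconv : ∀ z, I z ≠ ⊤ → ∀ V ∈ 𝓝 (F z), ∃ U ∈ 𝓝 z, ∃ m, ∀ n ≥ m, ∀ ω ∈ Ω₀,
      Z n ω ∈ U → Y n ω ∈ V) :
    SatisfiesLDP P Y a fun y => ⨅ (z : S) (_ : F z = y), I z := by
  have ha : ∀ᶠ n in atTop, 0 ≤ a n := h.tendsto_atTop.eventually_ge_atTop 0
  refine ⟨hY, h.tendsto_atTop, h.isRateFunction.map hF, fun C hC => ?_, fun G hG => ?_⟩
  -- `D m` is a closed set that contains `Z n ω` whenever `n ≥ m`, `ω ∈ Ω₀` and `Y n ω ∈ C`. For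
  -- each fixed `m` the upper bound for `Z` therefore controls the events `Y n ∈ C`.
  · set D : ℕ → Set S := fun m => closure {z | ∃ n ≥ m, ∃ ω ∈ Ω₀, Z n ω = z ∧ Y n ω ∈ C} with hD
    have hDanti : Antitone D := fun m m' hm => closure_mono
      fun z ⟨n, hn, hz⟩ => ⟨n, hm.trans hn, hz⟩
    have hupper : ∀ m, limsup (fun n => (((a n)⁻¹ : ℝ) : EReal)
        * ENNReal.log (P {ω | Y n ω ∈ C})) atTop ≤ -((⨅ z ∈ D m, I z : ℝ≥0∞) : EReal) := by
      intro m
      refine le_trans (limsup_le_limsup ?_) (h.upper (D m) isClosed_closure)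
      filter_upwards [ha, eventually_ge_atTop m] with n hn hm
      exact inv_mul_log_mono hn (measure_le_of_forall_mem h₀ fun ω hω hC' =>
        subset_closure ⟨n, hm, ω, hω, rfl, hC'⟩)
    rw [EReal.le_neg]
    -- If the bound failed, a finite `c` would exceed the infimum of `I` over every `D m`.
    -- Compactness of a level set then gives one `z` in all `D m` with `I z ≤ c`, and closeness of
    -- `Y n` to `F z` forces `F z ∈ C`.
    by_contra! hlt
    obtain ⟨c, hc1, hc2⟩ := EReal.lt_iff_exists_real_btwn.1 hlt
    have hmm : ∀ m, ((⨅ z ∈ D m, I z : ℝ≥0∞) : EReal) < c := fun m =>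
      lt_of_le_of_lt (EReal.le_neg.1 (hupper m)) hc1
    have hc0 : 0 ≤ c := by
      have := (EReal.coe_ennreal_nonneg _).trans (hmm 0).le
      exact_mod_cast this
    lift c to ℝ≥0 using hc0
    have hcc : ((c : ℝ) : EReal) = ((c : ℝ≥0∞) : EReal) := rfl
    rw [hcc] at hc2 hmm
    obtain ⟨z, hz, hzI⟩ := h.isRateFunction.exists_mem_iInter_le (fun m => isClosed_closure)
      hDanti (a := c) (fun m => EReal.coe_ennreal_lt_coe_ennreal_iff.1 (hmm m))
    have hzt : I z ≠ ⊤ := (hzI.trans_lt ENNReal.coe_lt_top).ne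
    have hzC : F z ∈ C := by
      by_contra hnot
      obtain ⟨U, hU, m, hm⟩ := hconv z hzt Cᶜ (hC.isOpen_compl.mem_nhds hnot)
      obtain ⟨w, hwU, n, hn, ω, hω, hZ, hYC⟩ := mem_closure_iff_nhds.1 (hz m) U hU
      exact hm n hn ω hω (hZ ▸ hwU) hYC
    have : (⨅ y ∈ C, ⨅ (z : S) (_ : F z = y), I z) ≤ (c : ℝ≥0∞) :=
      (iInf₂_le (F z) hzC).trans (iInf_le_of_le z (iInf_le_of_le rfl hzI))
    exact absurd (EReal.coe_ennreal_le_coe_ennreal_iff.2 this) (not_le.2 hc2)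
  · rw [EReal.neg_le]
    by_contra! hlt
    have hex : ∃ z, F z ∈ G ∧ ((I z : ℝ≥0∞) : EReal) < -liminf (fun n =>
        (((a n)⁻¹ : ℝ) : EReal) * ENNReal.log (P {ω | Y n ω ∈ G})) atTop := by
      obtain ⟨c, hc1, hc2⟩ := EReal.lt_iff_exists_real_btwn.1 hlt
      have hc0 : 0 ≤ c := by
        have := (EReal.coe_ennreal_nonneg _).trans hc1.le
        exact_mod_cast this
      lift c to ℝ≥0 using hc0
      have hcc : ((c : ℝ) : EReal) = ((c : ℝ≥0∞) : EReal) := rfl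
      rw [hcc] at hc1 hc2
      rw [EReal.coe_ennreal_lt_coe_ennreal_iff] at hc1
      simp only [iInf_lt_iff] at hc1
      obtain ⟨y, hy, z, rfl, hz⟩ := hc1
      exact ⟨z, hy, (EReal.coe_ennreal_lt_coe_ennreal_iff.2 hz).trans hc2⟩
    obtain ⟨z, hzG, hz⟩ := hex
    have hzt : I z ≠ ⊤ := by
      rintro h'
      rw [h', EReal.coe_ennreal_top] at hz
      exact not_top_lt hz
    -- From time `m` on, `Z n ∈ U` implies `Y n ∈ G` almost surely, so the lower bound for `Z` on
    -- the interior of `U` transfers.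
    obtain ⟨U, hU, m, hm⟩ := hconv z hzt G (hG.mem_nhds hzG)
    have h1 : -((I z : ℝ≥0∞) : EReal) ≤ liminf (fun n =>
        (((a n)⁻¹ : ℝ) : EReal) * ENNReal.log (P {ω | Y n ω ∈ G})) atTop := by
      calc -((I z : ℝ≥0∞) : EReal) ≤ -((⨅ y ∈ interior U, I y : ℝ≥0∞) : EReal) :=
            EReal.neg_le_neg_iff.2 (EReal.coe_ennreal_le_coe_ennreal_iff.2
              (iInf₂_le z (mem_interior_iff_mem_nhds.2 hU)))
        _ ≤ _ := h.lower _ isOpen_interior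
        _ ≤ _ := by
            refine liminf_le_liminf ?_
            filter_upwards [ha, eventually_ge_atTop m] with n hn hmn
            exact inv_mul_log_mono hn (measure_le_of_forall_mem h₀ fun ω hω hU' =>
              hm n hmn ω hω (interior_subset hU'))
    exact absurd (EReal.neg_le.1 h1) (not_le.2 hz)

end Contraction

/-! ### Neighbourhoods in the `J₁` topology -/

section Skorokhod

variable {T : ℝ} {E : Type*} [MetricSpace E]

/-- A `J₁`-neighbourhood of a continuous path is a uniform neighbourhood. -/
theorem eventually_dist_le_of_continuous {z : SkorokhodSpace T E} (hz : Continuous ⇑z) {η : ℝ}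
    (hη : 0 < η) : ∀ᶠ w in 𝓝 z, ∀ t, dist (w t) (z t) ≤ η := by
  obtain ⟨δ₁, hδ₁, hu⟩ := Metric.uniformContinuous_iff.1
    (CompactSpace.uniformContinuous_of_continuous hz) (η / 2) (by positivity)
  -- A time change of norm at most δ sends t into [t e^(-δ), t e^δ]. It thus moves points by at most
  -- the larger of these two quantities, which must fall below the modulus `δ₁`.
  have c1 : Tendsto (fun δ : ℝ => T * (Real.exp δ - 1)) (𝓝[>] 0) (𝓝 0) := by
    have : Continuous fun δ : ℝ => T * (Real.exp δ - 1) := by fun_prop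
    simpa using (this.tendsto 0).mono_left nhdsWithin_le_nhds
  have c2 : Tendsto (fun δ : ℝ => T * (1 - Real.exp (-δ))) (𝓝[>] 0) (𝓝 0) := by
    have : Continuous fun δ : ℝ => T * (1 - Real.exp (-δ)) := by fun_prop
    simpa using (this.tendsto 0).mono_left nhdsWithin_le_nhds
  have c3 : ∀ᶠ δ : ℝ in 𝓝[>] 0, δ < η / 2 :=
    nhdsWithin_le_nhds (eventually_lt_nhds (by positivity))
  obtain ⟨δ, h1, h2, h3, h4⟩ := ((c1.eventually_lt_const hδ₁).and
    ((c2.eventually_lt_const hδ₁).and (c3.and self_mem_nhdsWithin))).exists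
  have hδ0 : (0 : ℝ) < δ := h4
  filter_upwards [Metric.eball_mem_nhds z (ENNReal.ofReal_pos.2 hδ0)] with w hw t
  have hw' : skorokhodEDist w z < ENNReal.ofReal δ := hw
  obtain ⟨f, hf⟩ := iInf_lt_iff.1 hw'
  have hf1 : timeChangeNorm f ≤ ENNReal.ofReal δ := le_sup_left.trans hf.le
  have hf2 : dist (w t) (z (f t)) ≤ δ := by
    have : edist (w t) (z (f t)) ≤ ENNReal.ofReal δ :=
      (le_iSup (fun t => edist (w t) (z (f t))) t).trans (le_sup_right.trans hf.le)
    rwa [edist_dist, ENNReal.ofReal_le_ofReal_iff hδ0.le] at this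
  have hf3 : dist (f t) t < δ₁ := by
    rcases eq_or_lt_of_le t.2.1 with h0 | h0
    · have : f t = t := by
        refine le_antisymm ?_ (show (t : ℝ) ≤ f t from h0 ▸ (f t).2.1)
        have : t ≤ f.symm t := show (t : ℝ) ≤ f.symm t from h0 ▸ (f.symm t).2.1
        simpa using f.monotone this
      simpa [this] using hδ₁
    · obtain ⟨b1, b2⟩ := timeChange_bounds f hδ0.le hf1 t h0
      have htT : (t : ℝ) ≤ T := t.2.2
      have e1 : 0 ≤ Real.exp δ - 1 := by linarith [Real.add_one_le_exp δ]
      have e2 : 0 ≤ 1 - Real.exp (-δ) := by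
        have := Real.exp_le_one_iff.2 (neg_nonpos.2 hδ0.le); linarith
      have m1 := mul_le_mul_of_nonneg_right htT e1
      have m2 := mul_le_mul_of_nonneg_right htT e2
      rw [Subtype.dist_eq, Real.dist_eq, abs_lt]
      constructor <;> nlinarith
  have := dist_triangle (w t) (z (f t)) (z t)
  linarith [hu hf3]

/-- Uniformly close paths are `J₁`-close. -/
theorem edist_le_of_forall_dist_le {w z : SkorokhodSpace T E} {η : ℝ}
    (h : ∀ t, dist (w t) (z t) ≤ η) : edist w z ≤ ENNReal.ofReal η := by
  refine iInf_le_of_le (OrderIso.refl _) (sup_le ?_ (iSup_le fun t => ?_))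
  · simp [timeChangeNorm_refl]
  · rw [edist_dist]
    exact ENNReal.ofReal_le_ofReal (h t)

/-- `J₁`-balls around `z` contain uniform balls. -/
theorem exists_forall_dist_le_imp_mem {z : SkorokhodSpace T E} {V : Set (SkorokhodSpace T E)}
    (hV : V ∈ 𝓝 z) : ∃ η > 0, ∀ w : SkorokhodSpace T E, (∀ t, dist (w t) (z t) ≤ η) → w ∈ V := by
  obtain ⟨ε, hε, h⟩ := EMetric.mem_nhds_iff.1 hV
  obtain ⟨η, h0, hη⟩ := ENNReal.lt_iff_exists_nnreal_btwn.1 hε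
  refine ⟨η, by exact_mod_cast h0, fun w hw => h ?_⟩
  have := (edist_le_of_forall_dist_le hw)
  rw [ENNReal.ofReal_coe_nnreal] at this
  exact this.trans_lt hη

/-- The time change `t ↦ t + h t` for a function `h` with Lipschitz constant less than one that
vanishes at the end points. -/
theorem exists_timeChange_add_lipschitz (hT : 0 ≤ T) {h : ℝ → ℝ} {K : ℝ≥0} (hK : K < 1)
    (hh : LipschitzWith K h) (h0 : h 0 = 0) (hhT : h T = 0) :
    ∃ φ : Set.Icc (0 : ℝ) T ≃o Set.Icc (0 : ℝ) T, (∀ t, (φ t : ℝ) = t + h t) ∧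
      timeChangeNorm φ ≤ ENNReal.ofReal (-Real.log (1 - K)) := by
  have hK' : (K : ℝ) < 1 := by exact_mod_cast hK
  have hlip : ∀ s t : ℝ, s ≤ t → |h t - h s| ≤ K * (t - s) := fun s t hst => by
    have := hh.dist_le_mul t s
    rwa [Real.dist_eq, Real.dist_eq, abs_of_nonneg (sub_nonneg.2 hst)] at this
  have hmono : StrictMono fun t : ℝ => t + h t := fun s t hst => by
    have := abs_le.1 (hlip s t hst.le)
    have : (K : ℝ) * (t - s) < t - s := by nlinarith
    simp only; linarith
  have hmem : ∀ t : Set.Icc (0 : ℝ) T, (t : ℝ) + h t ∈ Set.Icc (0 : ℝ) T := fun t => by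
    have a1 := hmono.monotone t.2.1
    have a2 := hmono.monotone t.2.2
    simp only [h0, hhT, add_zero] at a1 a2
    exact ⟨a1, a2⟩
  have hcont : Continuous fun t : ℝ => t + h t := continuous_id.add hh.continuous
  have hsurj : Function.Surjective fun t : Set.Icc (0 : ℝ) T =>
      (⟨t + h t, hmem t⟩ : Set.Icc (0 : ℝ) T) := fun y => by
    have hy : (y : ℝ) ∈ Set.Icc (0 + h 0) (T + h T) := by simp [h0, hhT]
    obtain ⟨t, ht, hty⟩ := intermediate_value_Icc hT hcont.continuousOn hy
    exact ⟨⟨t, ht⟩, Subtype.ext hty⟩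
  refine ⟨StrictMono.orderIsoOfSurjective (fun t : Set.Icc (0 : ℝ) T =>
      (⟨t + h t, hmem t⟩ : Set.Icc (0 : ℝ) T)) (fun s t hst => hmono hst) hsurj,
    fun t => rfl, iSup_le fun s => iSup_le fun t => iSup_le fun hst => ?_⟩
  refine ENNReal.ofReal_le_ofReal ?_
  have hst' : (0 : ℝ) < t - s := sub_pos.2 hst
  have hb := abs_le.1 (hlip s t hst.le)
  change |Real.log (((t + h t : ℝ) - (s + h s)) / (t - s))| ≤ _
  -- The difference quotients lie in [1 - K, 1 + K], and 1 + K ≤ 1/(1 - K), so both logarithmic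
  -- bounds are -log(1 - K).
  have q1 : 1 - (K : ℝ) ≤ ((t + h t : ℝ) - (s + h s)) / (t - s) := by
    rw [le_div_iff₀ hst']; linarith
  have q2 : ((t + h t : ℝ) - (s + h s)) / (t - s) ≤ (1 - (K : ℝ))⁻¹ := by
    have : ((t + h t : ℝ) - (s + h s)) / (t - s) ≤ 1 + K := by
      rw [div_le_iff₀ hst']; linarith
    refine this.trans ?_
    rw [le_inv_comm₀ (by positivity) (by linarith), inv_eq_one_div, le_div_iff₀ (by positivity)]
    nlinarith [K.2]
  have p : 0 < 1 - (K : ℝ) := by linarith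
  rw [abs_le, neg_neg]
  refine ⟨Real.log_le_log p q1, ?_⟩
  rw [← Real.log_inv]
  exact Real.log_le_log (p.trans_le q1) q2

end Skorokhod

/-! ### Measurability of integer-valued RCLL processes -/

section Discrete

variable {T : ℝ}

theorem IsCadlag.comp_discrete {ι A E : Type*} [TopologicalSpace ι] [Preorder ι]
    [TopologicalSpace A] [DiscreteTopology A] [TopologicalSpace E] {f : ι → A} (hf : IsCadlag f)
    (g : A → E) : IsCadlag fun t => g (f t) := fun t => by
  refine ⟨continuous_of_discreteTopology.continuousAt.comp_continuousWithinAt (hf t).1, ?_⟩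
  obtain ⟨l, hl⟩ := (hf t).2
  exact ⟨g l, (continuous_of_discreteTopology.tendsto l).comp hl⟩

/-- An integer-valued RCLL path on a compact interval has finitely many jumps. -/
theorem IsCadlag.finite_not_continuousAt {A : Type*} [TopologicalSpace A] [DiscreteTopology A]
    {f : Set.Icc (0 : ℝ) T → A} (hf : IsCadlag f) : {t | ¬ ContinuousAt f t}.Finite := by
  by_contra hinf
  obtain ⟨t, ht⟩ := Set.Infinite.exists_accPt_principal hinf
  rw [accPt_iff_frequently_nhdsNE] at ht
  refine ht ?_
  -- A one-sided limit in a discrete space makes `f` constant on that side near `t`, hence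
  -- continuous at those points, so jumps cannot accumulate at `t`.
  have key : ∀ {U : Set (Set.Icc (0 : ℝ) T)} {a : A}, IsOpen U → Tendsto f (𝓝[U] t) (𝓝 a) →
      ∀ᶠ s in 𝓝[U] t, ¬ ¬ ContinuousAt f s := fun {U a} hU h => by
    rw [nhds_discrete A, tendsto_pure] at h
    filter_upwards [eventually_eventually_nhdsWithin.2 h, h, self_mem_nhdsWithin] with s hs hs' hsU
    rw [hU.nhdsWithin_eq hsU] at hs
    rw [not_not, ContinuousAt, hs', nhds_discrete A, tendsto_pure]
    exact hs
  rw [← Set.Iio_union_Ioi, nhdsWithin_union, eventually_sup]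
  obtain ⟨l, hl⟩ := (hf t).2
  exact ⟨key isOpen_Iio hl,
    key isOpen_Ioi ((hf t).1.mono_left (nhdsWithin_mono _ Set.Ioi_subset_Ici_self))⟩

/-- An integer-valued RCLL path is constant between its jumps. -/
theorem IsCadlag.eq_of_forall_jump {A : Type*} [TopologicalSpace A] [DiscreteTopology A]
    {f : Set.Icc (0 : ℝ) T → A} (hf : IsCadlag f) {u v : Set.Icc (0 : ℝ) T}
    (h : ∀ s, ¬ ContinuousAt f s → (s ≤ u ↔ s ≤ v)) : f u = f v := by
  wlog huv : u ≤ v generalizing u v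
  · exact (this (fun s hs => (h s hs).symm) (le_of_not_ge huv)).symm
  -- There is no jump in `(u, v]`, and at `u` right-continuity suffices; a continuous map from an
  -- interval to a discrete space is constant.
  have hc : ContinuousOn f (Set.Icc u v) := fun w hw => by
    rcases eq_or_lt_of_le hw.1 with rfl | hlt
    · exact (hf u).1.mono Set.Icc_subset_Ici_self
    · refine ContinuousAt.continuousWithinAt (by_contra fun hn => ?_)
      exact absurd ((h w hn).2 hw.2) (not_le.2 hlt)
  have hpre : IsPreconnected (Set.Icc u v) := by
    have : Set.Icc u v = Subtype.val ⁻¹' Set.Icc (u : ℝ) v := rfl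
    rw [this]
    refine (Topology.IsInducing.subtypeVal.isPreconnected_image).1 ?_
    rw [Subtype.image_preimage_coe, Set.inter_eq_right.2 (Set.Icc_subset_Icc u.2.1 v.2.2)]
    exact isPreconnected_Icc
  exact hpre.constant hc ⟨le_rfl, huv⟩ ⟨huv, le_rfl⟩

theorem isCadlag_floor_mul {q : ℝ} (hq : 0 < q) :
    IsCadlag fun t : Set.Icc (0 : ℝ) T => ⌊(t : ℝ) * q⌋₊ := fun t => by
  have ht0 : 0 ≤ (t : ℝ) * q := mul_nonneg t.2.1 hq.le
  have hcont : Continuous fun s : Set.Icc (0 : ℝ) T => (s : ℝ) * q := by fun_prop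
  constructor
  · have h1 : ∀ᶠ s : Set.Icc (0 : ℝ) T in 𝓝[≥] t, (s : ℝ) * q < ⌊(t : ℝ) * q⌋₊ + 1 :=
      nhdsWithin_le_nhds (hcont.continuousAt.eventually_lt_const (Nat.lt_floor_add_one _))
    rw [ContinuousWithinAt, nhds_discrete, tendsto_pure]
    filter_upwards [h1, self_mem_nhdsWithin] with s hs hts
    rw [Nat.floor_eq_iff (mul_nonneg s.2.1 hq.le)]
    exact ⟨(Nat.floor_le ht0).trans (mul_le_mul_of_nonneg_right hts hq.le), hs⟩
  -- The left limit is not the floor: at a grid point it is one lower. At `t = 0` the left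
  -- neighbourhood is empty, so the truncated subtraction is harmless.
  · refine ⟨⌈(t : ℝ) * q⌉₊ - 1, ?_⟩
    rw [nhds_discrete, tendsto_pure]
    rcases eq_or_lt_of_le ht0 with h0 | h0
    · filter_upwards [self_mem_nhdsWithin] with s (hs : (s : ℝ) < t)
      have := mul_lt_mul_of_pos_right hs hq
      exact absurd (mul_nonneg s.2.1 hq.le) (by linarith)
    · have hpos : 0 < ⌈(t : ℝ) * q⌉₊ := Nat.ceil_pos.2 h0
      have h1 : ((⌈(t : ℝ) * q⌉₊ - 1 : ℕ) : ℝ) < t * q := by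
        rw [← Nat.lt_ceil]; omega
      have h2 : ∀ᶠ s : Set.Icc (0 : ℝ) T in 𝓝[<] t, ((⌈(t : ℝ) * q⌉₊ - 1 : ℕ) : ℝ) < s * q :=
        nhdsWithin_le_nhds (hcont.continuousAt.eventually_const_lt h1)
      filter_upwards [h2, self_mem_nhdsWithin] with s hs (hst : (s : ℝ) < t)
      rw [Nat.floor_eq_iff (mul_nonneg s.2.1 hq.le)]
      refine ⟨hs.le, (mul_lt_mul_of_pos_right hst hq).trans_le ?_⟩
      rw [Nat.cast_sub hpos, Nat.cast_one, sub_add_cancel]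
      exact Nat.le_ceil _

/-- An RCLL function as an element of the Skorokhod space. -/
def IsCadlag.toPath {E : Type*} [TopologicalSpace E] {f : Set.Icc (0 : ℝ) T → E}
    (hf : IsCadlag f) : SkorokhodSpace T E :=
  ⟨f, hf⟩

/-- The step path with value `g (v k)` on the `k`-th of `k + 1` equal subintervals of `[0,T]`. -/
def stepPath (hT : 0 < T) {E : Type*} [TopologicalSpace E] (g : ℕ → E) (k : ℕ)
    (v : Fin (k + 2) → ℕ) : SkorokhodSpace T E :=
  -- The floor takes the values 0, …, k + 1, the last only at `t = T`; hence `k + 2` entries, and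
  -- `Fin.ofNat` never wraps around.
  ⟨fun t => g (v (Fin.ofNat (k + 2) ⌊(t : ℝ) * ((k + 1) / T)⌋₊)),
    (isCadlag_floor_mul (by positivity)).comp_discrete fun j => g (v (Fin.ofNat (k + 2) j))⟩

/-- The discretization of an integer-valued RCLL path converges to it in the `J₁` topology. -/
theorem tendsto_stepPath (hT : 0 < T) {E : Type*} [MetricSpace E] (g : ℕ → E) {f : ℝ≥0 → ℕ}
    (hf : IsCadlag fun t : Set.Icc (0 : ℝ) T => f (Real.toNNReal t)) :
    Tendsto (fun k : ℕ => stepPath hT g k fun j => f (Real.toNNReal (j / ((k + 1) / T)))) atTop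
      (𝓝 (hf.comp_discrete g).toPath) := by
  set F : Set.Icc (0 : ℝ) T → ℕ := fun t => f (Real.toNNReal t) with hF
  -- The end points join the jump times so that the time change fixes them, and so that `J` has two
  -- points and its minimal gap is positive.
  set J : Set ℝ := Subtype.val '' {t | ¬ ContinuousAt F t} ∪ {0, T} with hJ
  have hJfin : J.Finite := (hf.finite_not_continuousAt.image _).union (Set.toFinite _)
  have hJnt : J.Nontrivial := ⟨0, by simp [hJ], T, by simp [hJ], hT.ne⟩
  have hδ : 0 < J.infsep := hJfin.infsep_pos_iff_nontrivial.2 hJnt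
  have hJmem : ∀ s ∈ J, s ∈ Set.Icc (0 : ℝ) T := by
    rintro s (⟨t, -, rfl⟩ | rfl | rfl)
    · exact t.2
    · exact ⟨le_rfl, hT.le⟩
    · exact ⟨hT.le, le_rfl⟩
  set δ := J.infsep
  let K : ℕ → ℝ≥0 := fun k => Real.toNNReal (T / δ / (k + 1))
  have hKc : ∀ k, (K k : ℝ) = T / δ / (k + 1) := fun k => Real.coe_toNNReal _ (by positivity)
  have hKlim : Tendsto (fun k => (K k : ℝ)) atTop (𝓝 0) := by
    simp only [hKc]
    exact tendsto_const_nhds.div_atTop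
      (tendsto_atTop_add_const_right _ _ tendsto_natCast_atTop_atTop)
  rw [tendsto_iff_edist_tendsto_0]
  have hlim : Tendsto (fun k => ENNReal.ofReal (-Real.log (1 - K k))) atTop (𝓝 0) := by
    have : Tendsto (fun k => -Real.log (1 - K k)) atTop (𝓝 (-Real.log (1 - 0))) :=
      ((tendsto_const_nhds.sub hKlim).log (by norm_num)).neg
    simpa using ENNReal.tendsto_ofReal this
  refine tendsto_of_tendsto_of_tendsto_of_le_of_le' tendsto_const_nhds hlim
    (Eventually.of_forall fun _ => zero_le) ?_
  filter_upwards [hKlim.eventually_lt_const one_pos] with k hk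
  set q : ℝ := (k + 1) / T with hqdef
  have hq : 0 < q := by positivity
  have hTq : T * q = (k + 1 : ℕ) := by rw [hqdef]; push_cast; field_simp
  -- `c` rounds up to the grid of mesh 1/q = T/(k + 1). Sending each jump `s` to `c s` displaces it
  -- by at most one mesh, so on `J`, whose gaps are at least δ, the displacement has Lipschitz
  -- constant T/(δ(k + 1)) = `K k`.
  set c : ℝ → ℝ := fun s => ⌈s * q⌉₊ / q with hc
  have hc1 : ∀ s, s ≤ c s := fun s => (le_div_iff₀ hq).2 (Nat.le_ceil _)
  have hc2 : ∀ s, 0 ≤ s → c s ≤ s + 1 / q := fun s hs => by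
    rw [hc, div_le_iff₀ hq, add_mul, one_div_mul_cancel hq.ne']
    exact (Nat.ceil_lt_add_one (by positivity)).le
  have hlip : LipschitzOnWith (K k) (fun s => c s - s) J := by
    refine LipschitzOnWith.of_dist_le_mul fun s hs s' hs' => ?_
    rcases eq_or_ne s s' with rfl | hne
    · simp
    have hd : δ ≤ dist s s' := Set.infsep_le_dist_of_mem hs hs' hne
    calc dist (c s - s) (c s' - s') ≤ 1 / q := by
          rw [Real.dist_eq, abs_le]
          have := hc1 s; have := hc1 s'
          have := hc2 s (hJmem s hs).1; have := hc2 s' (hJmem s' hs').1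
          constructor <;> linarith
      _ = K k * δ := by rw [hKc, hqdef]; field_simp
      _ ≤ K k * dist s s' := mul_le_mul_of_nonneg_left hd (K k).2
  obtain ⟨h, hh, hhJ⟩ := hlip.extend_real
  have hh0 : h 0 = 0 := by
    rw [← hhJ (by simp [hJ] : (0 : ℝ) ∈ J)]; simp [hc]
  have hhT : h T = 0 := by
    rw [← hhJ (by simp [hJ] : T ∈ J)]
    simp only [hc, hTq, Nat.ceil_natCast]
    rw [← hTq]; field_simp; simp
  obtain ⟨φ, hφ, hφn⟩ := exists_timeChange_add_lipschitz hT.le (by exact_mod_cast hk) hh hh0 hhT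
  rw [edist_comm]
  refine iInf_le_of_le φ (sup_le hφn (iSup_le fun t => ?_))
  have hy0 : 0 ≤ (φ t : ℝ) * q := mul_nonneg (φ t).2.1 hq.le
  have hfl : (⌊(φ t : ℝ) * q⌋₊ : ℝ) ≤ T * q :=
    (Nat.floor_le hy0).trans (mul_le_mul_of_nonneg_right (φ t).2.2 hq.le)
  -- `u` is the grid point at which the step path samples `f` for time `φ t`. A jump `s` is at most
  -- `t` iff its image `c s` is at most `φ t`, iff `s ≤ u`; so no jump separates `t` from `u`, the
  -- values agree exactly, and only the norm of `φ` remains.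
  let u : Set.Icc (0 : ℝ) T := ⟨⌊(φ t : ℝ) * q⌋₊ / q, by positivity, (div_le_iff₀ hq).2 hfl⟩
  have hut : F t = F u := by
    refine hf.eq_of_forall_jump fun s hs => ?_
    have hsJ : (s : ℝ) ∈ J := Or.inl ⟨s, hs, rfl⟩
    have e1 : (φ s : ℝ) = c s := by rw [hφ, ← hhJ hsJ]; ring
    calc s ≤ t ↔ φ s ≤ φ t := φ.le_iff_le.symm
      _ ↔ c s ≤ φ t := by rw [← e1]; rfl
      _ ↔ s ≤ u := by
        rw [hc, div_le_iff₀ hq, ← Nat.le_floor_iff hy0, Nat.ceil_le, ← le_div_iff₀ hq]; rfl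
  have hlt : ⌊(φ t : ℝ) * q⌋₊ < k + 2 := by
    rw [hTq] at hfl
    have : ⌊(φ t : ℝ) * q⌋₊ ≤ k + 1 := by exact_mod_cast hfl
    omega
  have : g (F t) = g (f (Real.toNNReal
      ((Fin.ofNat (k + 2) ⌊(φ t : ℝ) * q⌋₊ : Fin (k + 2)) / q))) := by
    rw [hut]
    simp only [Fin.val_ofNat, Nat.mod_eq_of_lt hlt]
    rfl
  change edist (g (F t)) (g (f (Real.toNNReal
      ((Fin.ofNat (k + 2) ⌊(φ t : ℝ) * q⌋₊ : Fin (k + 2)) / q)))) ≤ _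
  rw [← this, edist_self]
  exact zero_le

theorem IsCadlag.restrict {E : Type*} [TopologicalSpace E] {f : ℝ≥0 → E} (hf : IsCadlag f) :
    IsCadlag fun t : Set.Icc (0 : ℝ) T => f (Real.toNNReal t) := fun t => by
  have hcont : Continuous fun s : Set.Icc (0 : ℝ) T => Real.toNNReal s := by fun_prop
  constructor
  · exact (hf _).1.comp hcont.continuousWithinAt fun s hs => Real.toNNReal_mono hs
  · obtain ⟨l, hl⟩ := (hf (Real.toNNReal t)).2
    refine ⟨l, hl.comp (tendsto_nhdsWithin_iff.2
      ⟨hcont.continuousAt.mono_left nhdsWithin_le_nhds, ?_⟩)⟩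
    filter_upwards [self_mem_nhdsWithin] with s hs
    have hst : (s : ℝ) < t := hs
    exact (Real.toNNReal_lt_toNNReal_iff (s.2.1.trans_lt hst)).2 hst

/-- A function of an integer-valued RCLL process is a random element of the Skorokhod space. -/
theorem aemeasurable_restrictPath (hT : 0 < T) {Ω E : Type*} [MeasurableSpace Ω] [MetricSpace E]
    [Zero E] {P : Measure Ω} {X : ℝ≥0 → Ω → ℕ} (hX : ∀ t, Measurable (X t))
    (hpath : ∀ᵐ ω ∂P, IsCadlag fun t => X t ω) (g : ℕ → E) :
    AEMeasurable (fun ω => restrictPath T fun t => g (X t ω)) P := by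
  refine aemeasurable_of_tendsto_metrizable_ae atTop
    (f := fun (k : ℕ) ω => stepPath hT g k fun j => X (Real.toNNReal (j / ((k + 1) / T))) ω)
    (fun k => ?_) ?_
  -- The sampled values range over a countable discrete space, so measurability holds for any
  -- σ-field on the target.
  · have : Measurable (stepPath (E := E) hT g k) := measurable_of_countable _
    exact (this.comp (measurable_pi_lambda _ fun j => hX _)).aemeasurable
  · filter_upwards [hpath] with ω hω
    have h1 := tendsto_stepPath hT g (f := fun t => X t ω) hω.restrict
    have h2 : restrictPath T (fun t => g (X t ω))
        = (hω.restrict.comp_discrete g).toPath :=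
      dif_pos (hω.restrict.comp_discrete g)
    rw [h2]
    exact h1

end Discrete

/-! ### The limit equation -/

section LimitEquation

variable {T : ℝ}

/-- An integral Gronwall inequality without continuity assumptions. -/
theorem le_of_le_const_add_integral {D e : ℝ → ℝ} {κ m : ℝ} (hT : 0 ≤ T) (hm : 0 < m)
    (he : IntervalIntegrable e volume 0 T) (he0 : ∀ t, 0 ≤ e t)
    (heD : ∀ t ∈ Set.Icc 0 T, e t ≤ D t)
    (hD : ∀ t ∈ Set.Icc 0 T, D t ≤ κ + m * ∫ s in (0 : ℝ)..t, e s) :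
    ∀ t ∈ Set.Icc 0 T, D t ≤ 2 * κ * Real.exp (2 * m * t) := by
  -- The weight e^(-2mt) has twice the Gronwall rate, so the integral term returns only half of the
  -- supremum: B ≤ κ + B/2. Integrability is needed only for `e`, not for `D`.
  set B : ℝ := sSup ((fun t => D t * Real.exp (-(2 * m * t))) '' Set.Icc 0 T) with hB
  have hsub : ∀ t ∈ Set.Icc 0 T, IntervalIntegrable e volume 0 t := fun t ht =>
    he.mono_set (by rw [Set.uIcc_of_le hT, Set.uIcc_of_le ht.1]; exact Set.Icc_subset_Icc_right ht.2)
  have hbdd : BddAbove ((fun t => D t * Real.exp (-(2 * m * t))) '' Set.Icc 0 T) := by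
    refine ⟨κ + m * ∫ s in (0 : ℝ)..T, e s, ?_⟩
    rintro _ ⟨t, ht, rfl⟩
    have h1 : D t ≤ κ + m * ∫ s in (0 : ℝ)..T, e s := by
      refine (hD t ht).trans ?_
      gcongr
      exact intervalIntegral.integral_mono_interval le_rfl ht.1 ht.2
        (Eventually.of_forall he0) he
    have h2 : 0 ≤ D t := (he0 t).trans (heD t ht)
    have h3 : Real.exp (-(2 * m * t)) ≤ 1 := by
      rw [Real.exp_le_one_iff]
      have := mul_nonneg hm.le ht.1; linarith
    exact (mul_le_of_le_one_right h2 h3).trans h1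
  have hDB : ∀ t ∈ Set.Icc 0 T, D t ≤ B * Real.exp (2 * m * t) := fun t ht => by
    have := le_csSup hbdd ⟨t, ht, rfl⟩
    rw [← hB] at this
    calc D t = D t * Real.exp (-(2 * m * t)) * Real.exp (2 * m * t) := by
          rw [mul_assoc, ← Real.exp_add]; simp
      _ ≤ _ := mul_le_mul_of_nonneg_right this (Real.exp_pos _).le
  have hB0 : 0 ≤ B := by
    have h0 : (0 : ℝ) ∈ Set.Icc 0 T := ⟨le_rfl, hT⟩
    have := hDB 0 h0
    simp only [mul_zero, Real.exp_zero, mul_one] at this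
    exact ((he0 0).trans (heD 0 h0)).trans this
  have hstep : ∀ t ∈ Set.Icc 0 T, D t ≤ κ + B / 2 * (Real.exp (2 * m * t) - 1) := fun t ht => by
    have hder : ∀ s ∈ Set.uIcc 0 t, HasDerivAt (fun s => B / (2 * m) * Real.exp (2 * m * s))
        (B * Real.exp (2 * m * s)) s := fun s _ => by
      have := ((((hasDerivAt_id s).const_mul (2 * m)).exp).const_mul (B / (2 * m)))
      refine this.congr_deriv ?_
      simp only [id]
      field_simp
    have hcont : Continuous fun s => B * Real.exp (2 * m * s) := by fun_prop
    have hint : ∫ s in (0 : ℝ)..t, e s ≤ B / (2 * m) * (Real.exp (2 * m * t) - 1) := by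
      calc ∫ s in (0 : ℝ)..t, e s ≤ ∫ s in (0 : ℝ)..t, B * Real.exp (2 * m * s) :=
            intervalIntegral.integral_mono_on ht.1 (hsub t ht) (hcont.intervalIntegrable _ _)
              fun s hs => (heD s ⟨hs.1, hs.2.trans ht.2⟩).trans (hDB s ⟨hs.1, hs.2.trans ht.2⟩)
        _ = _ := by
            rw [intervalIntegral.integral_eq_sub_of_hasDerivAt hder
              (hcont.intervalIntegrable _ _)]
            simp; ring
    calc D t ≤ κ + m * (B / (2 * m) * (Real.exp (2 * m * t) - 1)) :=
          (hD t ht).trans (by gcongr)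
      _ = _ := by field_simp
  have hexp : ∀ t ∈ Set.Icc 0 T, 1 ≤ Real.exp (2 * m * t) := fun t ht =>
    Real.one_le_exp (by have := mul_nonneg hm.le ht.1; linarith)
  have hκ : 0 ≤ κ := by
    have h0 : (0 : ℝ) ∈ Set.Icc 0 T := ⟨le_rfl, hT⟩
    have := hstep 0 h0
    simp only [mul_zero, Real.exp_zero, sub_self, add_zero] at this
    exact ((he0 0).trans (heD 0 h0)).trans this
  have hBκ : B ≤ κ + B / 2 := by
    refine csSup_le (Set.Nonempty.image _ ⟨0, le_rfl, hT⟩) ?_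
    rintro _ ⟨t, ht, rfl⟩
    simp only
    rw [Real.exp_neg, ← div_eq_mul_inv, div_le_iff₀ (Real.exp_pos _)]
    nlinarith [hstep t ht, hexp t ht]
  intro t ht
  refine (hDB t ht).trans (mul_le_mul_of_nonneg_right ?_ (Real.exp_pos _).le)
  linarith

/-- Right-continuous functions on the line are measurable. -/
theorem measurable_of_continuousWithinAt_Ici {E : Type*} [TopologicalSpace E]
    [TopologicalSpace.PseudoMetrizableSpace E] [MeasurableSpace E] [BorelSpace E] {f : ℝ → E}
    (hf : ∀ t, ContinuousWithinAt f (Set.Ici t) t) : Measurable f := by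
  -- Rounding the argument up to a grid approaches `t` from the right, where `f` is continuous.
  refine measurable_of_tendsto_metrizable
    (f := fun (n : ℕ) (t : ℝ) => f ((⌈t * (n + 1)⌉ : ℤ) / (n + 1))) (fun n => ?_) ?_
  · have h1 : Measurable fun k : ℤ => f (k / (n + 1)) := measurable_from_top
    exact h1.comp (Int.measurable_ceil.comp (measurable_id.mul_const _))
  · rw [tendsto_pi_nhds]
    intro t
    refine (hf t).tendsto.comp (tendsto_nhdsWithin_iff.2 ⟨?_, Eventually.of_forall fun n => ?_⟩)
    · have hlim : Tendsto (fun n : ℕ => t + 1 / ((n : ℝ) + 1)) atTop (𝓝 t) := by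
        simpa using tendsto_const_nhds.add (tendsto_one_div_add_atTop_nhds_zero_nat (𝕜 := ℝ))
      refine tendsto_of_tendsto_of_tendsto_of_le_of_le tendsto_const_nhds hlim (fun n => ?_)
        fun n => ?_
      · have hn : (0 : ℝ) < n + 1 := by positivity
        exact (le_div_iff₀ hn).2 (Int.le_ceil _)
      · have hn : (0 : ℝ) < n + 1 := by positivity
        simp only
        rw [div_le_iff₀ hn, add_mul, one_div_mul_cancel hn.ne']
        exact (Int.ceil_lt_add_one _).le
    · have hn : (0 : ℝ) < n + 1 := by positivity
      exact (le_div_iff₀ hn).2 (Int.le_ceil _)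

/-- The negative part of a solution of the limit equation is integrable. -/
theorem intervalIntegrable_negPart {u : ℝ → ℝ} (hu : Measurable u) {C : ℝ} (hT : 0 ≤ T)
    (hC : ∀ t ∈ Set.Icc 0 T, max (-u t) 0 ≤ C) :
    IntervalIntegrable (fun s => max (-u s) 0) volume 0 T := by
  refine (intervalIntegrable_const (c := C)).mono_fun
    (hu.neg.max measurable_const).aestronglyMeasurable ?_
  filter_upwards [ae_restrict_mem measurableSet_uIoc] with s hs
  rw [Set.uIoc_of_le hT] at hs
  have h0 : 0 ≤ max (-u s) 0 := le_max_right _ _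
  have h1 := hC s ⟨hs.1.le, hs.2⟩
  rw [Real.norm_of_nonneg h0, Real.norm_of_nonneg (h0.trans h1)]
  exact h1

/-- The feedback term is nonnegative, so it can only push `u` up and the lower bound on `a` passes
to `u`. This a priori bound does not depend on `m` or on Gronwall. -/
theorem negPart_le_of_eq {u a : ℝ → ℝ} {m C : ℝ} (hm : 0 ≤ m) (hC : 0 ≤ C)
    (hu : ∀ t ∈ Set.Icc 0 T, u t = a t + m * ∫ s in (0 : ℝ)..t, max (-u s) 0)
    (ha : ∀ t ∈ Set.Icc 0 T, -C ≤ a t) : ∀ t ∈ Set.Icc 0 T, max (-u t) 0 ≤ C := by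
  intro t ht
  have h1 : 0 ≤ ∫ s in (0 : ℝ)..t, max (-u s) 0 :=
    intervalIntegral.integral_nonneg ht.1 fun s _ => le_max_right _ _
  have := mul_nonneg hm h1
  exact max_le (by linarith [hu t ht, ha t ht]) hC

/-- Stability of the limit equation with respect to its data. -/
theorem abs_sub_le_of_eq_add_integral {u v a g : ℝ → ℝ} {m m' C κ : ℝ} (hT : 0 ≤ T) (hm : 0 < m)
    (hm' : 0 ≤ m') (hC : 0 ≤ C) (hmu : Measurable u) (hmv : Measurable v)
    (hu : ∀ t ∈ Set.Icc 0 T, u t = a t + m' * ∫ s in (0 : ℝ)..t, max (-u s) 0)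
    (hv : ∀ t ∈ Set.Icc 0 T, v t = g t + m * ∫ s in (0 : ℝ)..t, max (-v s) 0)
    (ha : ∀ t ∈ Set.Icc 0 T, -C ≤ a t) (hg : ∀ t ∈ Set.Icc 0 T, -C ≤ g t)
    (hag : ∀ t ∈ Set.Icc 0 T, |a t - g t| ≤ κ) :
    ∀ t ∈ Set.Icc 0 T, |u t - v t| ≤ 2 * (κ + |m' - m| * (C * T)) * Real.exp (2 * m * T) := by
  have hu1 := negPart_le_of_eq hm' hC hu ha
  have hv1 := negPart_le_of_eq hm.le hC hv hg
  have hui := intervalIntegrable_negPart hmu hT hu1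
  have hvi := intervalIntegrable_negPart hmv hT hv1
  have hsub : ∀ {f : ℝ → ℝ}, IntervalIntegrable f volume 0 T → ∀ t ∈ Set.Icc 0 T,
      IntervalIntegrable f volume 0 t := fun h t ht =>
    h.mono_set (by rw [Set.uIcc_of_le hT, Set.uIcc_of_le ht.1]; exact Set.Icc_subset_Icc_right ht.2)
  have hκ : 0 ≤ κ := (abs_nonneg _).trans (hag 0 ⟨le_rfl, hT⟩)
  have key := le_of_le_const_add_integral (D := fun t => |u t - v t|)
    (e := fun t => |max (-u t) 0 - max (-v t) 0|) (κ := κ + |m' - m| * (C * T)) hT hm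
    (hui.sub hvi).abs (fun t => abs_nonneg _) (fun t _ => by
      refine (abs_max_sub_max_le_abs _ _ _).trans_eq ?_
      rw [← abs_neg]; congr 1; ring) (fun t ht => by
      -- The discrepancy of rates is put on `∫ u⁻`, which is already bounded by `C * T`; what is
      -- left is a Gronwall term with rate `m`.
      have e1 : u t - v t = (a t - g t) + (m' - m) * (∫ s in (0 : ℝ)..t, max (-u s) 0)
          + m * ∫ s in (0 : ℝ)..t, (max (-u s) 0 - max (-v s) 0) := by
        rw [intervalIntegral.integral_sub (hsub hui t ht) (hsub hvi t ht), hu t ht, hv t ht]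
        ring
      have e2 : |∫ s in (0 : ℝ)..t, max (-u s) 0| ≤ C * T := by
        refine (intervalIntegral.norm_integral_le_of_norm_le_const (E := ℝ) (C := C)
          fun s hs => ?_).trans ?_
        · rw [Set.uIoc_of_le ht.1] at hs
          rw [Real.norm_of_nonneg (le_max_right _ _)]
          exact hu1 s ⟨hs.1.le, hs.2.trans ht.2⟩
        · rw [sub_zero, abs_of_nonneg ht.1]
          exact mul_le_mul_of_nonneg_left ht.2 hC
      have e3 : |∫ s in (0 : ℝ)..t, (max (-u s) 0 - max (-v s) 0)|
          ≤ ∫ s in (0 : ℝ)..t, |max (-u s) 0 - max (-v s) 0| :=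
        intervalIntegral.abs_integral_le_integral_abs ht.1
      rw [e1]
      refine (abs_add_three _ _ _).trans ?_
      rw [abs_mul, abs_mul, abs_of_pos hm]
      gcongr
      exact hag t ht)
  intro t ht
  refine (key t ht).trans ?_
  have : 0 ≤ C * T := mul_nonneg hC hT
  have h2 := ht.2
  gcongr

/-- Existence of solutions of the limit equation. -/
theorem exists_eq_add_integral_negPart (hT : 0 ≤ T) {m : ℝ} (hm : 0 < m) {g : ℝ → ℝ}
    (hg : Continuous g) : ∃ u : ℝ → ℝ, Continuous u ∧
      ∀ t ∈ Set.Icc 0 T, u t = g t + m * ∫ s in (0 : ℝ)..t, max (-u s) 0 := by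
  obtain ⟨B, hB⟩ := isCompact_Icc.exists_bound_of_continuousOn (s := Set.Icc 0 T) hg.continuousOn
  have hB0 : 0 ≤ B := (norm_nonneg _).trans (hB 0 ⟨le_rfl, hT⟩)
  -- Picard–Lindelöf is applied to w = u - g, with w' = m (g + w)⁻. Replacing w by `max w 0` bounds
  -- the right side by `m * B`, so one step covers all of [0, T]; the solution is nonnegative, so
  -- the truncation changes nothing.
  let f : ℝ → ℝ → ℝ := fun t y => m * max (-(g t + max y 0)) 0
  let t₀ : Set.Icc (0 : ℝ) T := ⟨0, le_rfl, hT⟩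
  have hf : IsPicardLindelof f t₀ 0 (Real.toNNReal (m * B * T)) 0 (Real.toNNReal (m * B))
      (Real.toNNReal m) := by
    refine ⟨fun t _ => ?_, fun y _ => ?_, fun t ht y _ => ?_, ?_⟩
    · refine LipschitzOnWith.of_dist_le_mul fun y _ y' _ => ?_
      rw [Real.coe_toNNReal _ hm.le, Real.dist_eq, Real.dist_eq, ← mul_sub, abs_mul, abs_of_pos hm]
      refine mul_le_mul_of_nonneg_left ((abs_max_sub_max_le_abs _ _ _).trans ?_) hm.le
      refine le_trans (le_of_eq ?_) (abs_max_sub_max_le_abs y y' 0)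
      rw [← abs_neg]; congr 1; ring
    · exact (by fun_prop : Continuous fun t => m * max (-(g t + max y 0)) 0).continuousOn
    · have h1 := (abs_le.1 (hB t ht)).1
      rw [Real.coe_toNNReal _ (by positivity), Real.norm_of_nonneg (by positivity)]
      exact mul_le_mul_of_nonneg_left (max_le (by linarith [le_max_right y 0]) hB0) hm.le
    · have : max (T - (t₀ : ℝ)) (t₀ - 0) = T := by simp [t₀, hT]
      rw [this, Real.coe_toNNReal _ (by positivity), Real.coe_toNNReal _ (by positivity)]
      simp
  have h0 : (0 : ℝ) ∈ Metric.closedBall (0 : ℝ) ((0 : ℝ≥0) : ℝ) := by simp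
  obtain ⟨α, hα⟩ := ODE.FunSpace.exists_isFixedPt_next hf h0
  have hαc : Continuous α.compProj := α.continuous_compProj
  have heq : ∀ t ∈ Set.Icc 0 T, α.compProj t = ∫ s in (0 : ℝ)..t, f s (α.compProj s) := by
    intro t ht
    have : α.compProj t = (ODE.FunSpace.next hf h0 α).compProj t := by rw [hα]
    rw [this, ODE.FunSpace.compProj_apply, ODE.FunSpace.next_apply, Set.projIcc_of_mem _ ht,
      ODE.picard_apply, zero_add]
  have hpos : ∀ t ∈ Set.Icc 0 T, 0 ≤ α.compProj t := fun t ht => by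
    rw [heq t ht]
    exact intervalIntegral.integral_nonneg ht.1 fun s _ => by positivity
  refine ⟨fun t => g t + α.compProj t, hg.add hαc, fun t ht => ?_⟩
  change g t + α.compProj t = _
  rw [heq t ht, ← intervalIntegral.integral_const_mul]
  congr 1
  refine intervalIntegral.integral_congr fun s hs => ?_
  rw [Set.uIcc_of_le ht.1] at hs
  simp only [f]
  rw [max_eq_left (hpos s ⟨hs.1, hs.2.trans ht.2⟩)]

end LimitEquation

/-! ### The solution map -/

section SolutionMap

variable {T : ℝ}

theorem measurable_IccExtend {E : Type*} [MetricSpace E] [MeasurableSpace E] [BorelSpace E]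
    (hT : 0 ≤ T) (ψ : SkorokhodSpace T E) : Measurable (Set.IccExtend hT ψ) := by
  refine measurable_of_continuousWithinAt_Ici fun t => ?_
  exact (ψ.2 (Set.projIcc 0 T hT t)).1.comp continuous_projIcc.continuousWithinAt
    fun s hs => Set.monotone_projIcc hT hs

/-- The free term of the limit equation. -/
def freeTerm (hT : 0 ≤ T) (x r : ℝ) (p : SkorokhodSpace T (EuclideanSpace ℝ (Fin 2))) (t : ℝ) :
    ℝ :=
  x + r * t + Set.IccExtend hT p t 0 - Set.IccExtend hT p t 1

theorem solvesLimitEquation_iff {hT : 0 ≤ T} {x r mu : ℝ}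
    {p : SkorokhodSpace T (EuclideanSpace ℝ (Fin 2))} {ψ : SkorokhodSpace T ℝ} :
    SolvesLimitEquation hT x r mu p ψ ↔ ∀ t ∈ Set.Icc 0 T, Set.IccExtend hT ψ t
      = freeTerm hT x r p t + mu * ∫ s in (0 : ℝ)..t, max (-(Set.IccExtend hT ψ s)) 0 := by
  refine ⟨fun h t ht => ?_, fun h t => ?_⟩
  · simp only [freeTerm, Set.IccExtend_of_mem hT _ ht]
    exact h ⟨t, ht⟩
  · have := h t t.2
    simpa only [freeTerm, Set.IccExtend_val] using this

theorem continuous_freeTerm (hT : 0 ≤ T) (x r : ℝ)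
    {p : SkorokhodSpace T (EuclideanSpace ℝ (Fin 2))} (hp : Continuous ⇑p) :
    Continuous (freeTerm hT x r p) := by
  have : Continuous (Set.IccExtend hT p) := hp.Icc_extend'
  unfold freeTerm
  fun_prop

theorem exists_freeTerm_bound (hT : 0 ≤ T) (x r : ℝ)
    {p : SkorokhodSpace T (EuclideanSpace ℝ (Fin 2))} (hp : Continuous ⇑p) :
    ∃ C, 0 ≤ C ∧ ∀ t ∈ Set.Icc 0 T, -C ≤ freeTerm hT x r p t := by
  obtain ⟨C, hC⟩ := isCompact_Icc.exists_bound_of_continuousOn (s := Set.Icc 0 T)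
    (continuous_freeTerm hT x r hp).continuousOn
  exact ⟨C, (norm_nonneg _).trans (hC 0 ⟨le_rfl, hT⟩), fun t ht => (abs_le.1 (hC t ht)).1⟩

theorem exists_solvesLimitEquation (hT : 0 ≤ T) (x r : ℝ) {mu : ℝ} (hmu : 0 < mu)
    {p : SkorokhodSpace T (EuclideanSpace ℝ (Fin 2))} (hp : Continuous ⇑p) :
    ∃ ψ, SolvesLimitEquation hT x r mu p ψ := by
  obtain ⟨u, hu, h⟩ := exists_eq_add_integral_negPart hT hmu (continuous_freeTerm hT x r hp)
  have hcad : IsCadlag fun t : Set.Icc (0 : ℝ) T => u t := fun t => by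
    have : Continuous fun t : Set.Icc (0 : ℝ) T => u t := by fun_prop
    exact ⟨this.continuousWithinAt, _, this.continuousWithinAt⟩
  refine ⟨hcad.toPath, fun t => ?_⟩
  have h1 := h t t.2
  simp only [freeTerm, Set.IccExtend_val] at h1
  refine h1.trans ?_
  congr 2
  refine intervalIntegral.integral_congr fun s hs => ?_
  rw [Set.uIcc_of_le t.2.1] at hs
  have : Set.IccExtend hT hcad.toPath s = u s :=
    Set.IccExtend_of_mem hT _ ⟨hs.1, hs.2.trans t.2.2⟩
  simp only [this]

theorem abs_apply_sub_le_dist (a b : EuclideanSpace ℝ (Fin 2)) (i : Fin 2) :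
    |a i - b i| ≤ dist a b := by
  rw [dist_eq_norm]
  exact PiLp.norm_apply_le (a - b) i

/-- The two coordinates of the driving path contribute 2η to the free term and the Gronwall bound
doubles it. Taking η = 0 gives uniqueness, and small η gives continuity of the solution map. -/
theorem SolvesLimitEquation.dist_le {hT : 0 ≤ T} {x r mu η : ℝ} (hmu : 0 < mu)
    {p q : SkorokhodSpace T (EuclideanSpace ℝ (Fin 2))} (hp : Continuous ⇑p) (hq : Continuous ⇑q)
    {ψ φ : SkorokhodSpace T ℝ} (hψ : SolvesLimitEquation hT x r mu p ψ)
    (hφ : SolvesLimitEquation hT x r mu q φ) (hpq : ∀ t, dist (p t) (q t) ≤ η)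
    (t : Set.Icc (0 : ℝ) T) : dist (ψ t) (φ t) ≤ 4 * η * Real.exp (2 * mu * T) := by
  obtain ⟨C, hC0, hC⟩ := exists_freeTerm_bound hT x r hp
  obtain ⟨C', hC0', hC'⟩ := exists_freeTerm_bound hT x r hq
  have h := abs_sub_le_of_eq_add_integral (C := max C C') (κ := 2 * η) hT hmu hmu.le
    (hC0.trans (le_max_left _ _)) (measurable_IccExtend hT ψ) (measurable_IccExtend hT φ)
    (solvesLimitEquation_iff.1 hψ) (solvesLimitEquation_iff.1 hφ)
    (fun t ht => (neg_le_neg (le_max_left _ _)).trans (hC t ht))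
    (fun t ht => (neg_le_neg (le_max_right _ _)).trans (hC' t ht))
    (fun t ht => by
      simp only [freeTerm, Set.IccExtend_of_mem hT _ ht]
      have h0 := (abs_apply_sub_le_dist _ _ 0).trans (hpq ⟨t, ht⟩)
      have h1 := (abs_apply_sub_le_dist _ _ 1).trans (hpq ⟨t, ht⟩)
      rw [abs_le] at *
      constructor <;> linarith) t t.2
  rw [Set.IccExtend_val, Set.IccExtend_val, sub_self, abs_zero, zero_mul, add_zero] at h
  rw [Real.dist_eq]
  linarith

open Classical in
/-- The solution of the limit equation driven by `p` (an arbitrary path if there is none). -/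
def limitSolution (hT : 0 ≤ T) (x r mu : ℝ)
    (p : SkorokhodSpace T (EuclideanSpace ℝ (Fin 2))) : SkorokhodSpace T ℝ :=
  if h : ∃ ψ, SolvesLimitEquation hT x r mu p ψ then h.choose else restrictPath T 0

theorem solvesLimitEquation_limitSolution (hT : 0 ≤ T) (x r : ℝ) {mu : ℝ} (hmu : 0 < mu)
    {p : SkorokhodSpace T (EuclideanSpace ℝ (Fin 2))} (hp : Continuous ⇑p) :
    SolvesLimitEquation hT x r mu p (limitSolution hT x r mu p) := by
  rw [limitSolution, dif_pos (exists_solvesLimitEquation hT x r hmu hp)]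
  exact (exists_solvesLimitEquation hT x r hmu hp).choose_spec

theorem limitSolution_eq_iff {hT : 0 ≤ T} {x r mu : ℝ} (hmu : 0 < mu)
    {p : SkorokhodSpace T (EuclideanSpace ℝ (Fin 2))} (hp : Continuous ⇑p)
    {ψ : SkorokhodSpace T ℝ} :
    limitSolution hT x r mu p = ψ ↔ SolvesLimitEquation hT x r mu p ψ := by
  have hs := solvesLimitEquation_limitSolution hT x r hmu hp
  refine ⟨fun h => h ▸ hs, fun h => Subtype.ext (funext fun t => dist_le_zero.1 ?_)⟩
  simpa using hs.dist_le hmu hp hp h (η := 0) (fun t => (dist_self _).le) t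

/-- At a continuous path J₁-closeness of the data is uniform closeness, where Gronwall stability
applies. -/
theorem continuousOn_limitSolution (hT : 0 ≤ T) (x r : ℝ) {mu : ℝ} (hmu : 0 < mu) :
    ContinuousOn (limitSolution hT x r mu) {p | Continuous ⇑p} := by
  intro p hp
  refine tendsto_iff_forall_eventually_mem.2 fun V hV => ?_
  obtain ⟨η, hη, hVη⟩ := exists_forall_dist_le_imp_mem hV
  have hpos : 0 < 4 * Real.exp (2 * mu * T) := by positivity
  filter_upwards [nhdsWithin_le_nhds (eventually_dist_le_of_continuous hp (div_pos hη hpos)),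
    self_mem_nhdsWithin] with w hw hwc
  refine hVη _ fun t => ?_
  refine ((solvesLimitEquation_limitSolution hT x r hmu hwc).dist_le hmu hwc hp
    (solvesLimitEquation_limitSolution hT x r hmu hp) hw t).trans_eq ?_
  field_simp

/-- For continuous `p` solving the equation and being the chosen solution coincide by uniqueness;
discontinuous `p` contribute `⊤` to both infima, whatever the default value. -/
theorem customersRate_eq (hT : 0 ≤ T) (x r : ℝ) {mu : ℝ} (hmu : 0 < mu)
    {I : SkorokhodSpace T (EuclideanSpace ℝ (Fin 2)) → ℝ≥0∞}
    (hI : ∀ p : SkorokhodSpace T (EuclideanSpace ℝ (Fin 2)), ¬ Continuous ⇑p → I p = ⊤) :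
    customersRate hT x r mu I = fun ψ => ⨅ (p) (_ : limitSolution hT x r mu p = ψ), I p := by
  funext ψ
  refine iInf_congr fun p => ?_
  by_cases hp : Continuous ⇑p
  · simp only [limitSolution_eq_iff hmu hp]
  · simp [hI p hp]

end SolutionMap

/-! ### Operations on RCLL paths -/

section Cadlag

variable {ι E F : Type*} [TopologicalSpace ι] [Preorder ι] [TopologicalSpace E]
  [TopologicalSpace F]

theorem IsCadlag.continuous_comp {f : ι → E} (hf : IsCadlag f) {g : E → F} (hg : Continuous g) :
    IsCadlag fun t => g (f t) := fun t => by
  obtain ⟨l, hl⟩ := (hf t).2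
  exact ⟨hg.continuousAt.comp_continuousWithinAt (hf t).1, g l, (hg.tendsto l).comp hl⟩

theorem IsCadlag.prodMk {f : ι → E} {g : ι → F} (hf : IsCadlag f) (hg : IsCadlag g) :
    IsCadlag fun t => (f t, g t) := fun t => by
  obtain ⟨l, hl⟩ := (hf t).2
  obtain ⟨l', hl'⟩ := (hg t).2
  exact ⟨(hf t).1.prodMk (hg t).1, (l, l'), hl.prodMk_nhds hl'⟩

theorem isCadlag_of_continuous {f : ι → E} (hf : Continuous f) : IsCadlag f := fun _ =>
  ⟨hf.continuousWithinAt, _, hf.continuousWithinAt⟩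

/-- A counting path run along a continuous nondecreasing clock. -/
theorem IsCadlag.comp_clock {S : ℝ≥0 → ℕ} (hS : IsCadlag S) (hmono : Monotone S)
    {σ : ℝ≥0 → ℝ≥0} (hσ : Continuous σ) (hσm : Monotone σ) :
    IsCadlag fun t => (S (σ t) : ℝ) := fun t => by
  constructor
  · have h1 : ContinuousWithinAt (fun t => S (σ t)) (Set.Ici t) t :=
      (hS (σ t)).1.comp hσ.continuousWithinAt fun s hs => hσm hs
    exact (continuous_of_discreteTopology (f := fun k : ℕ => (k : ℝ))).continuousAt
      |>.comp_continuousWithinAt h1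
  -- A clock that is flat to the left of `t` does not approach `σ t` from strictly below, so the
  -- left limit is taken from monotonicity instead of from `hS`.
  · have h2 : Monotone fun t => (S (σ t) : ℝ) := fun s t hst =>
      Nat.cast_le.2 (hmono (hσm hst))
    exact ⟨_, h2.tendsto_nhdsLT t⟩

end Cadlag

/-! ### Paths of the queue -/

section Queue

/-- The real path of an integer-valued RCLL path is measurable. -/
theorem measurable_toNNReal_of_isCadlag {f : ℝ≥0 → ℕ} (hf : IsCadlag f) :
    Measurable fun s : ℝ => f s.toNNReal :=
  measurable_of_continuousWithinAt_Ici fun t =>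
    (hf t.toNNReal).1.comp continuous_real_toNNReal.continuousWithinAt
      fun _ hs => Real.toNNReal_mono hs

/-- The customers in service, integrated over time. -/
def busyTime (N : ℕ) (f : ℝ≥0 → ℕ) (t : ℝ) : ℝ :=
  ∫ s in (0 : ℝ)..t, ((min (f s.toNNReal) N : ℕ) : ℝ)

variable {N : ℕ} {f : ℝ≥0 → ℕ}

theorem intervalIntegrable_busy (hf : IsCadlag f) (a b : ℝ) :
    IntervalIntegrable (fun s : ℝ => ((min (f s.toNNReal) N : ℕ) : ℝ)) volume a b := by
  refine (intervalIntegrable_const (c := (N : ℝ))).mono_fun ?_ (Eventually.of_forall fun s => ?_)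
  · have : Measurable fun k : ℕ => ((min k N : ℕ) : ℝ) := measurable_from_top
    exact (this.comp (measurable_toNNReal_of_isCadlag hf)).aestronglyMeasurable
  · change ‖((min (f s.toNNReal) N : ℕ) : ℝ)‖ ≤ ‖(N : ℝ)‖
    rw [Real.norm_of_nonneg (Nat.cast_nonneg _), Real.norm_of_nonneg (Nat.cast_nonneg _)]
    exact_mod_cast min_le_right _ _

theorem continuous_busyTime (hf : IsCadlag f) : Continuous (busyTime N f) :=
  intervalIntegral.continuous_primitive (fun a b => intervalIntegrable_busy hf a b) 0

theorem monotone_busyTime (hf : IsCadlag f) : Monotone (busyTime N f) := fun s t hst => by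
  have h : busyTime N f t - busyTime N f s
      = ∫ u in s..t, ((min (f u.toNNReal) N : ℕ) : ℝ) :=
    intervalIntegral.integral_interval_sub_left (intervalIntegrable_busy hf _ _)
      (intervalIntegrable_busy hf _ _)
  have : 0 ≤ ∫ u in s..t, ((min (f u.toNNReal) N : ℕ) : ℝ) :=
    intervalIntegral.integral_nonneg hst fun _ _ => Nat.cast_nonneg _
  linarith

theorem busyTime_nonneg {t : ℝ} (ht : 0 ≤ t) : 0 ≤ busyTime N f t :=
  intervalIntegral.integral_nonneg ht fun _ _ => Nat.cast_nonneg _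

/-- The busy time in terms of the negative part of a rescaled path. -/
theorem busyTime_eq (hf : IsCadlag f) {c : ℝ} (hc : 0 < c) {t : ℝ} (ht : 0 ≤ t) :
    busyTime N f t
      = N * t - c * ∫ s in (0 : ℝ)..t, max (-((f s.toNNReal - N) / c)) 0 := by
  have hpt : ∀ s : ℝ, ((min (f s.toNNReal) N : ℕ) : ℝ)
      = N - c * max (-((f s.toNNReal - N) / c)) 0 := fun s => by
    rw [mul_max_of_nonneg _ _ hc.le, mul_neg, mul_div_cancel₀ _ hc.ne', mul_zero, neg_sub]
    push_cast
    rcases le_total (f s.toNNReal : ℝ) N with h | h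
    · rw [min_eq_left h, max_eq_left (by linarith)]; ring
    · rw [min_eq_right h, max_eq_right (by linarith)]; ring
  have hmeas : Measurable fun s : ℝ => ((f s.toNNReal : ℝ) - N) / c := by
    have : Measurable fun k : ℕ => ((k : ℝ) - N) / c := measurable_from_top
    exact this.comp (measurable_toNNReal_of_isCadlag hf)
  have hint : IntervalIntegrable (fun s : ℝ => max (-(((f s.toNNReal : ℝ) - N) / c)) 0)
      volume 0 t := by
    refine intervalIntegrable_negPart hmeas (C := N / c) ht fun s _ => max_le ?_ (by positivity)
    rw [← neg_div]
    gcongr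
    have : (0 : ℝ) ≤ f s.toNNReal := Nat.cast_nonneg _
    linarith
  simp only [busyTime, hpt]
  rw [intervalIntegral.integral_sub intervalIntegrable_const (hint.const_mul c),
    intervalIntegral.integral_const, intervalIntegral.integral_const_mul, sub_zero, smul_eq_mul,
    mul_comm t]

/-- In a queue with RCLL paths satisfying the balance equation the arrival path is RCLL. -/
theorem isCadlag_arrivals_of_balance {A S : ℝ≥0 → ℕ} {mu : ℝ} (hmu : 0 ≤ mu) {x₀ : ℕ}
    (hS : IsCadlag S) (hSm : Monotone S) (hf : IsCadlag f)
    (hbal : ∀ t : ℝ≥0, (f t : ℤ) = x₀ + A t - S (Real.toNNReal (mu * busyTime N f t))) :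
    IsCadlag fun t => (A t : ℝ) := by
  have hc : Continuous fun t : ℝ≥0 => Real.toNNReal (mu * busyTime N f t) :=
    continuous_real_toNNReal.comp
      (continuous_const.mul ((continuous_busyTime hf).comp NNReal.continuous_coe))
  have hm : Monotone fun t : ℝ≥0 => Real.toNNReal (mu * busyTime N f t) := fun s t hst =>
    Real.toNNReal_mono (mul_le_mul_of_nonneg_left (monotone_busyTime hf hst) hmu)
  -- Solved for `A`, the balance equation is a sum of RCLL paths, which avoids analysing the renewal
  -- counts.
  have h1 := ((hf.comp_discrete fun k : ℕ => (k : ℝ)).prodMk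
    (hS.comp_clock hSm hc hm)).continuous_comp
      (g := fun q : ℝ × ℝ => q.1 + q.2 - x₀) (by fun_prop)
  convert h1 using 2 with t
  have : ((f t : ℤ) : ℝ) = ((x₀ + A t - S (Real.toNNReal (mu * busyTime N f t)) : ℤ) : ℝ) := by
    rw [hbal t]
  push_cast at this
  linarith

/-- The scaled primitives form an RCLL path. -/
theorem isCadlag_scaledPair {A S : ℝ≥0 → ℕ} (hA : IsCadlag fun t => (A t : ℝ)) (hS : IsCadlag S)
    (hSm : Monotone S) (n : ℕ) (b lam : ℝ) {mu : ℝ} (hmu : 0 ≤ mu) :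
    IsCadlag fun t : ℝ≥0 =>
      !₂[scaledArrivals n b lam A t, scaledServices n b N mu S t] := by
  have hc : Continuous fun t : ℝ≥0 => Real.toNNReal (N * mu * t) := by fun_prop
  have hm : Monotone fun t : ℝ≥0 => Real.toNNReal (N * mu * t) := fun s t hst =>
    Real.toNNReal_mono (mul_le_mul_of_nonneg_left (by exact_mod_cast hst) (by positivity))
  exact ((hA.prodMk (hS.comp_clock hSm hc hm)).prodMk
    (isCadlag_of_continuous NNReal.continuous_coe)).continuous_comp
      (g := fun q : (ℝ × ℝ) × ℝ =>
        !₂[(q.1.1 - lam * q.2) / (b * √n), (q.1.2 - N * mu * q.2) / (b * √n)]) (by fun_prop)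

/-- The scaled balance equation: the number of customers solves the limit equation driven by the
scaled arrivals and the scaled services run along the clock `t - b / √n * ∫₀ᵗ X̃⁻`. -/
theorem scaledCustomers_eq {A S : ℝ≥0 → ℕ} {n : ℕ} (hn : 1 ≤ n) {b lam mu : ℝ} (hb : 0 < b)
    {x₀ : ℕ} (hf : IsCadlag f)
    (hbal : ∀ t : ℝ≥0, (f t : ℤ) = x₀ + A t - S (Real.toNNReal (mu * busyTime n f t)))
    {t τ : ℝ} (ht : 0 ≤ t)
    (hτ : τ = t - b / √n * ∫ s in (0 : ℝ)..t, max (-(scaledCustomers n b n f s.toNNReal)) 0) :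
    0 ≤ τ ∧ scaledCustomers n b n f t.toNNReal
      = ((x₀ - n) / (b * √n) + √n / b * (lam / n - n * mu / n) * t
        + scaledArrivals n b lam A t.toNNReal - scaledServices n b n mu S τ.toNNReal)
        + mu * ∫ s in (0 : ℝ)..t, max (-(scaledCustomers n b n f s.toNNReal)) 0 := by
  have hn0 : (0 : ℝ) < n := by exact_mod_cast hn
  have hs : 0 < √(n : ℝ) := Real.sqrt_pos.2 hn0
  have hss : (n : ℝ) = √(n : ℝ) * √(n : ℝ) := (Real.mul_self_sqrt hn0.le).symm
  have hc : 0 < b * √(n : ℝ) := mul_pos hb hs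
  set J := ∫ s in (0 : ℝ)..t, max (-(scaledCustomers n b n f s.toNNReal)) 0 with hJ
  have hbusy : busyTime n f t = n * t - b * √n * J := busyTime_eq hf hc ht
  have hbτ : busyTime n f t = n * τ := by
    rw [hbusy, hτ]
    have : (n : ℝ) * (b / √n * J) = b * √n * J := by
      nth_rewrite 1 [hss]; field_simp
    linarith
  have hτ0 : 0 ≤ τ := by
    have h0 : 0 ≤ n * τ := hbτ ▸ busyTime_nonneg ht
    exact nonneg_of_mul_nonneg_right h0 hn0
  refine ⟨hτ0, ?_⟩
  have h1 := hbal t.toNNReal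
  rw [Real.coe_toNNReal _ ht, hbτ] at h1
  have h2 : (f t.toNNReal : ℝ) = x₀ + A t.toNNReal - S (Real.toNNReal (mu * (n * τ))) := by
    exact_mod_cast h1
  have h3 : mu * (n * τ) = n * mu * τ := by ring
  rw [h3] at h2
  -- The services are centred at n μ τ rather than n μ t; the difference n μ (t - τ)/(b√n) is
  -- exactly the feedback term μ J.
  have hJτ : J = (t - τ) * √n / b := by rw [hτ]; field_simp; ring
  rw [hJτ]
  simp only [scaledCustomers, scaledArrivals, scaledServices, Real.coe_toNNReal _ ht,
    Real.coe_toNNReal _ hτ0]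
  rw [h2]
  have hr : √(n : ℝ) / b * (lam / n - n * mu / n) * t = (lam - n * mu) * t / (b * √n) := by
    rw [← sub_div, div_mul_div_comm, div_mul_eq_mul_div, div_eq_div_iff (by positivity) hc.ne']
    linear_combination (-(lam - n * mu) * b * t) * hss
  have hl : mu * ((t - τ) * √n / b) = n * mu * (t - τ) / (b * √n) := by
    nth_rewrite 2 [hss]; field_simp
  rw [hr, hl]
  ring

end Queue

/-! ### Convergence of the queue along converging primitives -/

section Convergence

variable {T : ℝ}

/-- If the scaled primitives are close to a path `z`, the scaled number of customers is
close to the solution of the limit equation driven by `z`. -/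
theorem dist_scaledCustomers_le (hT : 0 ≤ T) {x r mu : ℝ} (hmu : 0 < mu)
    {z : SkorokhodSpace T (EuclideanSpace ℝ (Fin 2))}
    {ψ : SkorokhodSpace T ℝ} (hψ : SolvesLimitEquation hT x r mu z ψ)
    {C ρ δ : ℝ} (hC0 : 0 ≤ C) (hδ0 : 0 ≤ δ) (hC : ∀ t ∈ Set.Icc 0 T, -C ≤ freeTerm hT x r z t)
    (hρ : ∀ s t : Set.Icc (0 : ℝ) T, dist s t < ρ → dist (z s) (z t) ≤ δ)
    {n : ℕ} (hn : 1 ≤ n) {b lamn mun : ℝ} (hb : 0 < b) (hmun : 0 ≤ mun) {x₀ : ℕ}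
    {A S f : ℝ≥0 → ℕ} (hf : IsCadlag f)
    (hbal : ∀ t : ℝ≥0, (f t : ℤ) = x₀ + A t - S (Real.toNNReal (mun * busyTime n f t)))
    (hclose : ∀ t : Set.Icc (0 : ℝ) T, dist (!₂[scaledArrivals n b lamn A (Real.toNNReal t),
      scaledServices n b n mun S (Real.toNNReal t)]) (z t) ≤ δ)
    (hCz : ∀ t, ‖z t‖ ≤ C)
    (hx : |(x₀ - n) / (b * √n) - x| ≤ δ)
    (hr : |√n / b * (lamn / n - n * mun / n) - r| * T ≤ δ)
    (hm : |mun - mu| * ((3 * C + 4 * δ) * T) ≤ δ)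
    (hρn : b / √n * ((3 * C + 4 * δ) * T) < ρ) (t : Set.Icc (0 : ℝ) T) :
    |scaledCustomers n b n f (Real.toNNReal t) - ψ t| ≤ 12 * δ * Real.exp (2 * mu * T) := by
  set U : ℝ → ℝ := fun s => scaledCustomers n b n f s.toNNReal with hU
  set τ : ℝ → ℝ := fun t => t - b / √n * ∫ s in (0 : ℝ)..t, max (-(U s)) 0 with hτdef
  set a : ℝ → ℝ := fun t => (x₀ - n) / (b * √n) + √n / b * (lamn / n - n * mun / n) * t
    + scaledArrivals n b lamn A t.toNNReal - scaledServices n b n mun S (τ t).toNNReal with ha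
  have hbn : 0 ≤ b / √(n : ℝ) := by positivity
  have hUm : Measurable U := by
    have : Measurable fun k : ℕ => ((k : ℝ) - n) / (b * √n) := measurable_from_top
    exact this.comp (measurable_toNNReal_of_isCadlag hf)
  have hUeq : ∀ t ∈ Set.Icc 0 T, 0 ≤ τ t ∧ U t = a t + mun * ∫ s in (0 : ℝ)..t, max (-(U s)) 0 :=
    fun t ht => scaledCustomers_eq hn hb hf hbal ht.1 rfl
  have hτ : ∀ t ∈ Set.Icc 0 T, τ t ∈ Set.Icc 0 T := fun t ht => by
    refine ⟨(hUeq t ht).1, (sub_le_self _ (mul_nonneg hbn ?_)).trans ht.2⟩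
    exact intervalIntegral.integral_nonneg ht.1 fun s _ => le_max_right _ _
  have hA : ∀ t (ht : t ∈ Set.Icc 0 T),
      |scaledArrivals n b lamn A t.toNNReal - z ⟨t, ht⟩ 0| ≤ δ := fun t ht =>
    (abs_apply_sub_le_dist _ _ 0).trans (hclose ⟨t, ht⟩)
  have hS : ∀ t (ht : t ∈ Set.Icc 0 T),
      |scaledServices n b n mun S t.toNNReal - z ⟨t, ht⟩ 1| ≤ δ := fun t ht =>
    (abs_apply_sub_le_dist _ _ 1).trans (hclose ⟨t, ht⟩)
  -- The four errors δ come from the initial value, the drift, the arrivals and the services at time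
  -- `τ t`; the delay adds the oscillation of `z` between `τ t` and `t`.
  have hag : ∀ t (ht : t ∈ Set.Icc 0 T), |a t - freeTerm hT x r z t|
      ≤ 4 * δ + |z ⟨τ t, hτ t ht⟩ 1 - z ⟨t, ht⟩ 1| := fun t ht => by
    have hr' : |(√n / b * (lamn / n - n * mun / n) - r) * t| ≤ δ := by
      rw [abs_mul, abs_of_nonneg ht.1]
      exact (mul_le_mul_of_nonneg_left ht.2 (abs_nonneg _)).trans hr
    have h1 := hA t ht
    have h2 := hS (τ t) (hτ t ht)
    have e : a t - freeTerm hT x r z t = ((x₀ - n) / (b * √n) - x)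
        + (√n / b * (lamn / n - n * mun / n) - r) * t
        + (scaledArrivals n b lamn A t.toNNReal - z ⟨t, ht⟩ 0)
        - (scaledServices n b n mun S (τ t).toNNReal - z ⟨τ t, hτ t ht⟩ 1)
        - (z ⟨τ t, hτ t ht⟩ 1 - z ⟨t, ht⟩ 1) := by
      simp only [ha, freeTerm, Set.IccExtend_of_mem hT _ ht]
      ring
    rw [e]
    have b1 := abs_le.1 hx
    have b2 := abs_le.1 hr'
    have b3 := abs_le.1 h1
    have b4 := abs_le.1 h2
    have b5 := le_abs_self (z ⟨τ t, hτ t ht⟩ 1 - z ⟨t, ht⟩ 1)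
    have b6 := neg_abs_le (z ⟨τ t, hτ t ht⟩ 1 - z ⟨t, ht⟩ 1)
    rw [abs_le]
    constructor <;> linarith
  -- First pass: the oscillation is bounded crudely by 2C. The resulting bound on X̃⁻ limits the
  -- delay to less than ρ, and in the second pass (`hdist`) the oscillation is at most δ.
  have haC : ∀ t ∈ Set.Icc 0 T, -(3 * C + 4 * δ) ≤ a t := fun t ht => by
    have h1 := (abs_le.1 (hag t ht)).1
    have h2 : |z ⟨τ t, hτ t ht⟩ 1 - z ⟨t, ht⟩ 1| ≤ C + C :=
      (abs_sub _ _).trans (add_le_add ((PiLp.norm_apply_le _ 1).trans (hCz _))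
        ((PiLp.norm_apply_le _ 1).trans (hCz _)))
    linarith [hC t ht]
  have hC4 : 0 ≤ 3 * C + 4 * δ := by positivity
  have hneg := negPart_le_of_eq hmun hC4 (fun t ht => (hUeq t ht).2) haC
  have hdist : ∀ t (ht : t ∈ Set.Icc 0 T), |a t - freeTerm hT x r z t| ≤ 5 * δ := fun t ht => by
    have h1 : ∫ s in (0 : ℝ)..t, max (-(U s)) 0 ≤ (3 * C + 4 * δ) * T := by
      have : ‖∫ s in (0 : ℝ)..t, max (-(U s)) 0‖ ≤ (3 * C + 4 * δ) * |t - 0| := by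
        refine intervalIntegral.norm_integral_le_of_norm_le_const fun s hs => ?_
        rw [Set.uIoc_of_le ht.1] at hs
        rw [Real.norm_of_nonneg (le_max_right _ _)]
        exact hneg s ⟨hs.1.le, hs.2.trans ht.2⟩
      rw [sub_zero, abs_of_nonneg ht.1] at this
      exact (le_abs_self _).trans (this.trans (mul_le_mul_of_nonneg_left ht.2 hC4))
    have h2 : |t - τ t| < ρ := by
      have h3 : t - τ t = b / √n * ∫ s in (0 : ℝ)..t, max (-(U s)) 0 := by
        simp only [hτdef]; ring
      have h4 : 0 ≤ ∫ s in (0 : ℝ)..t, max (-(U s)) 0 :=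
        intervalIntegral.integral_nonneg ht.1 fun s _ => le_max_right _ _
      rw [h3, abs_of_nonneg (mul_nonneg hbn h4)]
      exact (mul_le_mul_of_nonneg_left h1 hbn).trans_lt hρn
    have h5 := (abs_apply_sub_le_dist _ _ 1).trans
      (hρ ⟨τ t, hτ t ht⟩ ⟨t, ht⟩ (by rwa [dist_comm, Subtype.dist_eq, Real.dist_eq]))
    linarith [hag t ht]
  have hCC : C ≤ 3 * C + 4 * δ := by linarith
  have key := abs_sub_le_of_eq_add_integral hT hmu hmun hC4 hUm (measurable_IccExtend hT ψ)
    (fun t ht => (hUeq t ht).2) (solvesLimitEquation_iff.1 hψ) haC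
    (fun t ht => (neg_le_neg hCC).trans (hC t ht)) hdist t t.2
  rw [Set.IccExtend_val] at key
  -- The constant is 2 (5δ + δ) = 12δ, the last δ being the error of the service rate.
  refine key.trans (mul_le_mul_of_nonneg_right ?_ (Real.exp_pos _).le)
  linarith

theorem restrictPath_apply {E : Type*} [TopologicalSpace E] [Zero E] {f : ℝ≥0 → E}
    (hf : IsCadlag f) (t : Set.Icc (0 : ℝ) T) : restrictPath T f t = f (Real.toNNReal t) := by
  have : restrictPath T f = hf.restrict.toPath := dif_pos hf.restrict
  rw [this]
  rfl

/-- Eventually the scaled number of customers is close to the solution of the limit equation when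
the scaled primitives are close to its driving path. -/
theorem exists_nhds_scaledCustomers_mem (hT : 0 ≤ T) {x r mu : ℝ} (hmu : 0 < mu)
    {lamn mun b : ℕ → ℝ} {x₀ : ℕ → ℕ} (hmun : ∀ n, 1 ≤ n → 0 < mun n)
    (hb : Tendsto b atTop atTop) (hb' : Tendsto (fun n => b n / √(n : ℝ)) atTop (𝓝 0))
    (hmulim : Tendsto mun atTop (𝓝 mu))
    (hr : Tendsto (fun n : ℕ => √(n : ℝ) / b n * (lamn n / n - n * mun n / n)) atTop (𝓝 r))
    (hx : Tendsto (fun n => ((x₀ n : ℝ) - n) / (b n * √(n : ℝ))) atTop (𝓝 x))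
    {z : SkorokhodSpace T (EuclideanSpace ℝ (Fin 2))} (hz : Continuous ⇑z)
    {ψ : SkorokhodSpace T ℝ} (hψ : SolvesLimitEquation hT x r mu z ψ)
    {V : Set (SkorokhodSpace T ℝ)} (hV : V ∈ 𝓝 ψ) :
    ∃ U ∈ 𝓝 z, ∃ m, ∀ n ≥ m, 1 ≤ n ∧ ∀ A S f : ℝ≥0 → ℕ, IsCadlag S → Monotone S → IsCadlag f →
      (∀ t : ℝ≥0, (f t : ℤ) = x₀ n + A t
        - S (Real.toNNReal (mun n * busyTime n f t))) →
      restrictPath T (fun t => !₂[scaledArrivals n (b n) (lamn n) A t,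
        scaledServices n (b n) n (mun n) S t]) ∈ U →
      restrictPath T (scaledCustomers n (b n) n f) ∈ V := by
  obtain ⟨η, hη, hVη⟩ := exists_forall_dist_le_imp_mem hV
  obtain ⟨C₁, hC₁0, hC₁⟩ := exists_freeTerm_bound hT x r hz
  obtain ⟨C₂, hC₂⟩ := isCompact_univ.exists_bound_of_continuousOn hz.continuousOn
  set C := max C₁ C₂
  have hC0 : 0 ≤ C := hC₁0.trans (le_max_left _ _)
  set δ : ℝ := η / (12 * Real.exp (2 * mu * T)) with hδdef
  have hδ : 0 < δ := by positivity
  obtain ⟨ρ, hρ0, hρ⟩ := Metric.uniformContinuous_iff.1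
    (CompactSpace.uniformContinuous_of_continuous hz) δ hδ
  have l1 : ∀ᶠ n in atTop, |((x₀ n : ℝ) - n) / (b n * √(n : ℝ)) - x| < δ :=
    (Metric.tendsto_nhds.1 hx) δ hδ
  have l2 : ∀ᶠ n : ℕ in atTop,
      |√(n : ℝ) / b n * (lamn n / n - n * mun n / n) - r| * T < δ := by
    have := ((hr.sub_const r).abs.mul_const T)
    rw [sub_self, abs_zero, zero_mul] at this
    exact this.eventually_lt_const hδ
  have l3 : ∀ᶠ n : ℕ in atTop, |mun n - mu| * ((3 * C + 4 * δ) * T) < δ := by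
    have := ((hmulim.sub_const mu).abs.mul_const ((3 * C + 4 * δ) * T))
    rw [sub_self, abs_zero, zero_mul] at this
    exact this.eventually_lt_const hδ
  have l4 : ∀ᶠ n : ℕ in atTop, b n / √(n : ℝ) * ((3 * C + 4 * δ) * T) < ρ := by
    have := hb'.mul_const ((3 * C + 4 * δ) * T)
    rw [zero_mul] at this
    exact this.eventually_lt_const hρ0
  obtain ⟨m, hm⟩ := eventually_atTop.1 (l1.and (l2.and (l3.and (l4.and
    ((hb.eventually_gt_atTop 0).and (eventually_ge_atTop 1))))))
  refine ⟨_, eventually_dist_le_of_continuous hz hδ, m, fun n hn => ?_⟩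
  obtain ⟨h1, h2, h3, h4, hbn, hn1⟩ := hm n hn
  refine ⟨hn1, fun A S f hS hSm hf hbal hclose => hVη _ fun t => ?_⟩
  have hfc : IsCadlag (scaledCustomers n (b n) n f) :=
    hf.comp_discrete fun k : ℕ => ((k : ℝ) - n) / (b n * √(n : ℝ))
  have hpair := isCadlag_scaledPair (N := n)
    (isCadlag_arrivals_of_balance (hmun n hn1).le hS hSm hf hbal) hS hSm n (b n) (lamn n)
    (hmun n hn1).le
  rw [restrictPath_apply hfc, Real.dist_eq]
  refine (dist_scaledCustomers_le hT hmu hψ hC0 hδ.le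
    (fun t ht => (neg_le_neg (le_max_left _ _)).trans (hC₁ t ht))
    (fun s t hst => (hρ hst).le) hn1 hbn (hmun n hn1).le hf hbal (fun t => ?_)
    (fun t => (hC₂ t trivial).trans (le_max_right _ _)) h1.le h2.le h3.le h4 t).trans_eq ?_
  · have := hclose t
    rwa [restrictPath_apply hpair] at this
  · rw [hδdef]
    field_simp

end Convergence

end GMN

end

theorem mainTheorem2 {Ω : Type*} [MeasurableSpace Ω] (P : Measure Ω) [IsProbabilityMeasure P]
    -- primitives: inter-arrival times, Poisson clock, and their independence
    (IA : ℕ → Ω → ℝ) (hIA : GMN.IsInterArrivalSequence P IA)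
    (S : ℝ≥0 → Ω → ℕ) (hS : GMN.IsStandardPoissonProcess P S)
    (hindep : IndepFun (fun ω k => IA k ω) (fun ω t => S t ω) P)
    -- parameters and their asymptotics
    (N : ℕ → ℕ) (hN : ∀ n, N n = n)
    (lamn mun b : ℕ → ℝ) (hlamn : ∀ n, 1 ≤ n → 0 < lamn n) (hmun : ∀ n, 1 ≤ n → 0 < mun n)
    (hb : Tendsto b atTop atTop) (hb' : Tendsto (fun n => b n / √(n : ℝ)) atTop (𝓝 0))
    (lam mu r : ℝ) (hlam : 0 < lam) (hmu : 0 < mu)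
    (hlamlim : Tendsto (fun n => lamn n / n) atTop (𝓝 lam))
    (hmulim : Tendsto (fun n => N n * mun n / n) atTop (𝓝 mu))
    (hr : Tendsto (fun n : ℕ => √(n : ℝ) / b n * (lamn n / n - N n * mun n / n)) atTop (𝓝 r))
    -- the number of customers in the system, with deterministic initial value
    (x₀ : ℕ → ℕ) (X : ℕ → ℝ≥0 → Ω → ℕ)
    (hX : ∀ n, 1 ≤ n →
      GMN.IsCustomerProcess P (N n) (mun n) (GMN.arrivals IA (lamn n)) S (x₀ n) (X n))
    (x : ℝ) (hx : Tendsto (fun n => ((x₀ n : ℝ) - N n) / (b n * √(n : ℝ))) atTop (𝓝 x))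
    -- the LDP for the pair of scaled primitives
    (T : ℝ) (hT : 0 < T)
    (I : GMN.SkorokhodSpace T (EuclideanSpace ℝ (Fin 2)) → ℝ≥0∞)
    (hI : ∀ p : GMN.SkorokhodSpace T (EuclideanSpace ℝ (Fin 2)), ¬ Continuous ⇑p → I p = ⊤)
    (hLDP : GMN.SatisfiesLDP P
      (fun n ω => GMN.restrictPath T fun t =>
        !₂[GMN.scaledArrivals n (b n) (lamn n) (fun t => GMN.arrivals IA (lamn n) t ω) t,
          GMN.scaledServices n (b n) (N n) (mun n) (fun t => S t ω) t])
      (fun n => b n ^ 2) I) :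
    GMN.SatisfiesLDP P
      (fun n ω => GMN.restrictPath T (GMN.scaledCustomers n (b n) (N n) (fun t => X n t ω)))
      (fun n => b n ^ 2) (GMN.customersRate hT.le x r mu I) := by
  obtain rfl : N = fun n => n := funext hN
  beta_reduce at *
  have hmulim' : Tendsto mun atTop (𝓝 mu) := by
    refine hmulim.congr' ?_
    filter_upwards [eventually_ge_atTop 1] with n hn
    have : (n : ℝ) ≠ 0 := by exact_mod_cast (by omega : n ≠ 0)
    field_simp
  -- A single almost sure event serves all `n`, as the contraction principle requires.
  have hgood : ∀ᵐ ω ∂P, (Monotone (fun t => S t ω) ∧ GMN.IsCadlag (fun t => S t ω)) ∧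
      ∀ n, 1 ≤ n → GMN.IsCadlag (fun t => X n t ω) ∧ ∀ t : ℝ≥0, (X n t ω : ℤ) = x₀ n
        + GMN.arrivals IA (lamn n) t ω
        - S (Real.toNNReal (mun n * GMN.busyTime n (fun t => X n t ω) t)) ω := by
    refine hS.paths.and (ae_all_iff.2 fun n => ?_)
    by_cases hn : 1 ≤ n
    · filter_upwards [(hX n hn).paths, (hX n hn).balance] with ω h1 h2 _ using ⟨h1, h2⟩
    · exact Eventually.of_forall fun ω h => absurd h hn
  have hcont : ∀ p : GMN.SkorokhodSpace T (EuclideanSpace ℝ (Fin 2)), I p ≠ ⊤ → Continuous ⇑p :=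
    fun p hp => by_contra fun h => hp (hI p h)
  rw [GMN.customersRate_eq hT.le x r hmu hI]
  refine hLDP.extended_contraction (fun n => ?_)
    ((GMN.continuousOn_limitSolution hT.le x r hmu).mono hcont) hgood fun z hz V hV => ?_
  -- The queue is given only for n ≥ 1, yet measurability is needed for every `n`; at n = 0 the
  -- divisor `b 0 * √0` vanishes and the scaled path is identically zero.
  · rcases Nat.eq_zero_or_pos n with rfl | hn
    · have h0 : ∀ f : ℝ≥0 → ℕ, GMN.scaledCustomers 0 (b 0) 0 f = fun _ => 0 := fun f => by
        funext t
        simp [GMN.scaledCustomers]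
      simp only [h0]
      exact aemeasurable_const
    · exact GMN.aemeasurable_restrictPath hT (hX n hn).measurable (hX n hn).paths
        fun k : ℕ => ((k : ℝ) - n) / (b n * √(n : ℝ))
  · obtain ⟨U, hU, m, hm⟩ := GMN.exists_nhds_scaledCustomers_mem hT.le hmu hmun hb hb' hmulim' hr hx
      (hcont z hz) (GMN.solvesLimitEquation_limitSolution hT.le x r hmu (hcont z hz)) hV
    refine ⟨U, hU, m, fun n hn ω hω hZ => ?_⟩
    obtain ⟨hn1, h⟩ := hm n hn
    exact h (fun t => GMN.arrivals IA (lamn n) t ω) _ _ hω.1.2 hω.1.1 (hω.2 n hn1).1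
      (hω.2 n hn1).2 hZ
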